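/- Let $(X_n)_{n\ge 1}$ be a sequence of finite sets, each with at least two elements. The rooted tree $T$ defined by this sequence has as vertices all finite strings $x_1\cdots x_n$ with $n\ge 0$ and $x_i\in X_i$, the empty string being the root, and its edges join $x_1\cdots x_n$ to $x_1\cdots x_nx_{n+1}$. The $n$-th layer of $T$ is the set of strings of length $n$, and $\operatorname{Aut}(T)$ is the group of graph automorphisms of $T$ fixing the root. Let $G\le\operatorname{Aut}(T)$. For a vertex $v$ in the $n$-th layer, let $\operatorname{rist}_G(v)$ be the subgroup of all elements of $G$ that fix the $n$-th layer pointwise and fix every vertex lying below a vertex $u\ne v$ of the $n$-th layer; let $\operatorname{Rist}_G(n)$ be the subgroup generated by all $\operatorname{rist}_G(v)$ with $v$ in the $n$-th layer. The group $G$ is called a branch group if it acts transitively on every layer of $T$ and $\operatorname{Rist}_G(n)$ has finite index in $G$ for every $n\ge 0$. **Corollary 3.6.** There exists a finitely generated branch group with uncountably many maximal subgroups. That is, there are a sequence $(X_n)_{n\ge1}$ of finite sets, each with at least two elements, with associated rooted tree $T$, and a finitely generated branch group $G\le\operatorname{Aut}(T)$ such that the set of maximal subgroups of $G$ is uncountable.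 -/

import Mathlib

namespace RootedTree

/-- Vertices of the rooted tree defined by the sequence `X 0, X 1, …` : finite strings
`x₀ x₁ … x_{n-1}` with `xᵢ ∈ X i`. -/
def Vertex (X : ℕ → Type) : Type := Σ n : ℕ, ((i : Fin n) → X i)

variable {X : ℕ → Type}

/-- The length of a string, i.e. the distance of the vertex to the root. -/
def Vertex.length (v : Vertex X) : ℕ := v.1

/-- The empty string. -/
def root (X : ℕ → Type) : Vertex X := ⟨0, fun i => i.elim0⟩

/-- The string `u` is an initial segment of the string `w`; equivalently, `w` lies in the subtree
below `u`. -/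
def Vertex.IsPrefix (u w : Vertex X) : Prop :=
  ∃ h : u.1 ≤ w.1, ∀ i : Fin u.1, w.2 (Fin.castLE h i) = u.2 i

/-- The tree as a graph: edges join `x₀ … x_{n-1}` and `x₀ … x_{n-1} x_n`. -/
def graph (X : ℕ → Type) : SimpleGraph (Vertex X) where
  Adj u w := (u.IsPrefix w ∧ w.length = u.length + 1) ∨ (w.IsPrefix u ∧ u.length = w.length + 1)
  symm := ⟨fun _ _ h => Or.symm h⟩
  loopless := ⟨fun v h => by rcases h with h | h <;> omega⟩

/-- The automorphism group of the rooted tree: the graph automorphisms fixing the root. -/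
def Aut (X : ℕ → Type) : Subgroup (graph X ≃g graph X) where
  carrier := {g | g (root X) = root X}
  one_mem' := rfl
  mul_mem' {a b} ha hb := by
    change a (b (root X)) = root X
    rw [show b (root X) = root X from hb]; exact ha
  inv_mem' {a} ha := by
    change a.symm (root X) = root X
    exact a.symm_apply_eq.2 (Eq.symm ha)

/-- `G` acts transitively on every layer of the tree. -/
def SphericallyTransitive (G : Subgroup (Aut X)) : Prop :=
  ∀ u w : Vertex X, u.length = w.length → ∃ g ∈ G, g.1 u = w

/-- The pointwise stabiliser in `G` of a set of vertices. -/
def pointwiseStabilizer (G : Subgroup (Aut X)) (S : Set (Vertex X)) : Subgroup (Aut X) where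
  carrier := {g | g ∈ G ∧ ∀ w ∈ S, g.1 w = w}
  one_mem' := ⟨G.one_mem, fun _ _ => rfl⟩
  mul_mem' {a b} ha hb := ⟨G.mul_mem ha.1 hb.1, fun w hw => by
    change a.1 (b.1 w) = w
    rw [hb.2 w hw, ha.2 w hw]⟩
  inv_mem' {a} ha := ⟨G.inv_mem ha.1, fun w hw => by
    change a.1.symm w = w
    exact a.1.symm_apply_eq.2 (ha.2 w hw).symm⟩

/-- The pointwise stabiliser in `G` of the `n`-th layer. -/
def layerStabilizer (G : Subgroup (Aut X)) (n : ℕ) : Subgroup (Aut X) :=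
  pointwiseStabilizer G {w | w.length = n}

/-- The rigid vertex stabiliser of `v`: the elements of `G` that fix the layer of `v` pointwise and
have trivial section at every vertex `u ≠ v` of that layer. As `u` is fixed, the section at `u` is
trivial if and only if every vertex below `u` is fixed. -/
def rigidVertexStabilizer (G : Subgroup (Aut X)) (v : Vertex X) : Subgroup (Aut X) :=
  layerStabilizer G v.length ⊓
    pointwiseStabilizer G {w | ∃ u : Vertex X, u.length = v.length ∧ u ≠ v ∧ u.IsPrefix w}

/-- The `n`-th rigid layer stabiliser, generated by the rigid stabilisers of the vertices of the
`n`-th layer. -/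
def rigidLayerStabilizer (G : Subgroup (Aut X)) (n : ℕ) : Subgroup (Aut X) :=
  ⨆ v : {v : Vertex X // v.length = n}, rigidVertexStabilizer G v.1

/-- A branch group: spherically transitive, with all rigid layer stabilisers of finite index
in `G`. -/
def IsBranch (G : Subgroup (Aut X)) : Prop :=
  SphericallyTransitive G ∧ ∀ n : ℕ, ((rigidLayerStabilizer G n).subgroupOf G).FiniteIndex

end RootedTree

/-! In a finitely generated group every proper subgroup lies in a maximal one. So an uncountable
family of proper subgroups, any two of which generate the group, gives uncountably many maximal
subgroups (`not_countable_isCoatom`). The task is to build a branch group with such a family.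

Take the letters `Fin (n + 3)`, `o = 0`, `e = 1`, and a subgroup `B` of the product of the symmetric
groups on these sets. A member of `B` acts as a directed automorphism: where a boundary point leaves
the spine `0, 0, …` with the letter `1`, the next letter is permuted by the corresponding component.
These automorphisms and the permutations of the first letter generate `G`. If `B` is generated by
finitely many elements of finite order and projects onto every factor, then `G` is branch
(`isBranch_range`): it contains the commutator subgroups of the analogous groups at all vertices
(`commutator_vertexGroup_le`), and on each level these generate a subgroup of finite index, since
finitely many torsion elements generate a group with finite abelianization.

The germ of a directed element at the spine determines its family up to finitely many coordinates
(`eventually_eq_of_directed_mem`). Hence proper subgroups of `B` closed under eventual equality give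
proper subgroups of `G`, and pairs generating `B` give pairs generating `G`.

For `B` take `PathGroup.group`, generated by four matchings of paths, one of which encodes the
binary digits of `n`. Along indices whose digits converge to `s : ℕ → Bool`, the actions converge to
an action on `ℕ`. It is doubly transitive, as each transposition comes from one member of `B` for
all large `n`; so the stabilizer of `0` is maximal in `B`. Distinct `s` have distinct stabilizers,
so any two generate `B` (`limitStabilizer_sup`). -/

/-! ### Maximal subgroups and commutator subgroups of abstract groups. -/

namespace GroupLemmas

variable {Γ : Type*} [Group Γ]

/-- In a finitely generated group every proper subgroup lies in a maximal subgroup. -/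
theorem isCoatomic_subgroup_of_fg (h : Group.FG Γ) : IsCoatomic (Subgroup Γ) := by
  refine IsCoatomic.of_isChain_bounded fun {c} hc hne htop => ?_
  refine ⟨sSup c, fun h_top => htop ?_, fun x hx => le_sSup hx⟩
  obtain ⟨S, hS⟩ := (Group.fg_def.1 h : (⊤ : Subgroup Γ).FG)
  -- A finite subset of the union of a chain lies in one member; applied to a generating set, this
  -- puts `⊤` into the chain.
  have key : ∀ F : Finset Γ, ∃ K ∈ c, ∀ x ∈ F, x ∈ K := by
    classical
    intro F
    induction F using Finset.induction_on with
    | empty => exact ⟨hne.some, hne.some_mem, by simp⟩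
    | insert a F _ ih =>
      obtain ⟨K, hK, hKF⟩ := ih
      have ha : a ∈ sSup c := h_top ▸ Subgroup.mem_top a
      obtain ⟨L, hL, haL⟩ := (Subgroup.mem_sSup_of_directedOn hne hc.directedOn).1 ha
      rcases hc.total hK hL with hle | hle
      · exact ⟨L, hL, by simpa [haL] using fun x hx => hle (hKF x hx)⟩
      · exact ⟨K, hK, by simpa [hle haL] using hKF⟩
  obtain ⟨K, hK, hSK⟩ := key S
  have : K = ⊤ := top_le_iff.1 (hS ▸ (Subgroup.closure_le K).2 hSK)
  exact this ▸ hK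

/-- A family of proper subgroups any two of which generate the whole group gives rise to pairwise
distinct maximal subgroups. -/
theorem not_countable_isCoatom {S : Type*} [Uncountable S] (h : Group.FG Γ)
    (K : S → Subgroup Γ) (hK : ∀ s, K s ≠ ⊤) (hsup : ∀ s t, s ≠ t → K s ⊔ K t = ⊤) :
    ¬ {M : Subgroup Γ | IsCoatom M}.Countable := by
  have := isCoatomic_subgroup_of_fg h
  have hex : ∀ s, ∃ M : Subgroup Γ, IsCoatom M ∧ K s ≤ M := fun s =>
    (eq_top_or_exists_le_coatom (K s)).resolve_left (hK s)
  choose M hM hKM using hex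
  intro hc
  have hinj : Function.Injective fun s => (⟨M s, hM s⟩ : {M : Subgroup Γ | IsCoatom M}) := by
    intro s t hst
    by_contra hne
    have hst' : M s = M t := congrArg Subtype.val hst
    exact (hM s).1 (top_le_iff.1 (hsup s t hne ▸ sup_le (hKM s) (hst' ▸ hKM t)))
  have := hc.to_subtype
  exact not_countable (α := S) hinj.countable

/-- A group generated by finitely many elements of finite order has finite abelianization. -/
theorem finiteIndex_commutator {U : Set Γ} (hU : U.Finite) (hgen : Subgroup.closure U = ⊤)
    (hfin : ∀ u ∈ U, IsOfFinOrder u) : (commutator Γ).FiniteIndex := by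
  have hgen' : Subgroup.closure (Abelianization.of '' U) = ⊤ := by
    rw [← MonoidHom.map_closure, hgen, ← MonoidHom.range_eq_map, MonoidHom.range_eq_top]
    exact QuotientGroup.mk_surjective
  have : Group.FG (Abelianization Γ) :=
    Group.fg_iff.2 ⟨_, hgen', hU.image _⟩
  have htor : IsMulTorsion (Abelianization Γ) := by
    have : CommGroup.torsion (Abelianization Γ) = ⊤ := by
      rw [← top_le_iff, ← hgen', Subgroup.closure_le]
      rintro _ ⟨u, hu, rfl⟩
      exact Abelianization.of.isOfFinOrder (hfin u hu)
    intro g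
    exact (this ▸ Subgroup.mem_top g : g ∈ CommGroup.torsion (Abelianization Γ))
  have hfinite : Finite (Abelianization Γ) := CommGroup.finite_of_fg_isMulTorsion _ htor
  have : Finite (Γ ⧸ commutator Γ) := hfinite
  exact Subgroup.finiteIndex_of_finite_quotient

theorem relIndex_ne_zero_of_commutator_le {U : Set Γ} (hU : U.Finite)
    (hfin : ∀ u ∈ U, IsOfFinOrder u) {D : Subgroup Γ}
    (hD : ⁅Subgroup.closure U, Subgroup.closure U⁆ ≤ D) :
    D.relIndex (Subgroup.closure U) ≠ 0 := by
  have h := finiteIndex_commutator (Γ := Subgroup.closure U)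
    (hU.preimage Subtype.val_injective.injOn) Subgroup.closure_closure_coe_preimage
    (fun u hu => Submonoid.isOfFinOrder_coe.1 (hfin _ hu))
  have hle : commutator (Subgroup.closure U) ≤ D.subgroupOf (Subgroup.closure U) := by
    rw [commutator_def, Subgroup.commutator_le]
    intro a _ b _
    exact hD (Subgroup.commutator_mem_commutator a.2 b.2)
  exact (Subgroup.finiteIndex_of_le hle).index_ne_zero

/-- If pairwise commuting subgroups generate `P`, then the commutator subgroup of `P` is generated
by the commutator subgroups of the factors. -/
theorem commutator_iSup_le {ι : Type*} [Finite ι] (H : ι → Subgroup Γ)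
    (hcomm : Pairwise fun i j : ι => ∀ x y : Γ, x ∈ H i → y ∈ H j → Commute x y) :
    ⁅⨆ i, H i, ⨆ i, H i⁆ ≤ ⨆ i, ⁅H i, H i⁆ := by
  have := Fintype.ofFinite ι
  rw [Subgroup.commutator_le, ← Subgroup.noncommPiCoprod_range (hcomm := hcomm)]
  rintro _ ⟨f, rfl⟩ _ ⟨g, rfl⟩
  rw [← map_commutatorElement, Subgroup.noncommPiCoprod_apply]
  refine Subgroup.noncommProd_mem _ _ fun i _ => ?_
  exact Subgroup.mem_iSup_of_mem i (Subgroup.commutator_mem_commutator (f i).2 (g i).2)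

end GroupLemmas

/-! ### Rooted and directed automorphisms as permutations of the boundary. -/

namespace BoundaryAction

open Equiv

variable {X : ℕ → Type}

/-- Two boundary points of the tree agree in their first `n` letters. -/
def Agree (n : ℕ) (x y : ∀ i, X i) : Prop := ∀ i < n, x i = y i

theorem Agree.refl (n : ℕ) (x : ∀ i, X i) : Agree n x x := fun _ _ => rfl

theorem Agree.symm {n : ℕ} {x y : ∀ i, X i} (h : Agree n x y) : Agree n y x :=
  fun i hi => (h i hi).symm

theorem Agree.trans {n : ℕ} {x y z : ∀ i, X i} (h : Agree n x y) (h' : Agree n y z) :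
    Agree n x z := fun i hi => (h i hi).trans (h' i hi)

theorem Agree.mono {m n : ℕ} {x y : ∀ i, X i} (h : Agree n x y) (hmn : m ≤ n) : Agree m x y :=
  fun i hi => h i (hi.trans_le hmn)

theorem Agree.succ {n : ℕ} {x y : ∀ i, X i} (h : Agree n x y) (hn : x n = y n) :
    Agree (n + 1) x y := fun i hi => by
  rcases Nat.lt_succ_iff_lt_or_eq.1 hi with h' | rfl
  exacts [h i h', hn]

theorem agree_update (n : ℕ) (w : ∀ i, X i) (a : X n) : Agree n (Function.update w n a) w :=
  fun i hi => by rw [Function.update_of_ne hi.ne]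

theorem agree_succ_update {n : ℕ} {x w : ∀ i, X i} {a : X n} :
    Agree (n + 1) x (Function.update w n a) ↔ Agree n x w ∧ x n = a := by
  refine ⟨fun h => ⟨(h.mono n.le_succ).trans (agree_update n w a), ?_⟩, fun h =>
    (h.1.trans (agree_update n w a).symm).succ ?_⟩
  · simpa using h n n.lt_succ_self
  · simpa using h.2

/-- The permutations of the boundary induced by automorphisms of the tree. -/
def levelPreserving (X : ℕ → Type) : Subgroup (Perm (∀ i, X i)) where
  carrier := {f | ∀ n x y, Agree n (f x) (f y) ↔ Agree n x y}
  one_mem' _ _ _ := Iff.rfl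
  mul_mem' {f g} hf hg n x y := (hf n (g x) (g y)).trans (hg n x y)
  inv_mem' {f} hf n x y := by
    simpa using (hf n (f⁻¹ x) (f⁻¹ y)).symm

/-- The permutations that fix every point outside a given set. -/
def supportedOn {Y : Type*} (C : Set Y) : Subgroup (Perm Y) where
  carrier := {f | ∀ x ∉ C, f x = x}
  one_mem' _ _ := rfl
  mul_mem' {f g} hf hg x hx := by rw [Perm.mul_apply, hg x hx, hf x hx]
  inv_mem' {f} hf x hx := by rw [Perm.inv_eq_iff_eq, hf x hx]

theorem commute_of_supportedOn {Y : Type*} {C D : Set Y} (h : Disjoint C D) {f g : Perm Y}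
    (hf : f ∈ supportedOn C) (hg : g ∈ supportedOn D) : Commute f g := by
  refine Perm.Disjoint.commute fun x => ?_
  by_cases hx : x ∈ C
  · exact Or.inr (hg x (Set.disjoint_left.1 h hx))
  · exact Or.inl (hf x hx)

/-- The boundary points below the vertex of level `n` on the path to `w`. -/
def cone (w : ∀ i, X i) (n : ℕ) : Set (∀ i, X i) := {x | Agree n x w}

theorem disjoint_cone {w w' : ∀ i, X i} {n : ℕ} (h : ¬ Agree n w w') :
    Disjoint (cone w n) (cone w' n) :=
  Set.disjoint_left.2 fun _ hx hx' => h (hx.symm.trans hx')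

theorem disjoint_cone_update (w : ∀ i, X i) (n : ℕ) {a b : X n} (h : a ≠ b) :
    Disjoint (cone (Function.update w n a) (n + 1)) (cone (Function.update w n b) (n + 1)) :=
  Set.disjoint_left.2 fun _ hx hx' =>
    h ((agree_succ_update.1 hx).2.symm.trans (agree_succ_update.1 hx').2)

/-- A rule that selects at most one letter of each boundary point, where the selection of the
`i`-th letter depends only on the preceding letters. -/
structure Gate (X : ℕ → Type) where
  IsOpen : ℕ → (∀ i, X i) → Prop
  isOpen_of_agree : ∀ {i x y}, Agree i x y → IsOpen i x → IsOpen i y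
  eq_of_isOpen : ∀ {i j x}, IsOpen i x → IsOpen j x → i = j

namespace Gate

variable (c : Gate X)

open Classical in
/-- Apply a permutation to the selected letter. -/
noncomputable def act (q : ∀ i, Perm (X i)) (x : ∀ i, X i) : ∀ i, X i :=
  fun i => if c.IsOpen i x then q i (x i) else x i

variable {c} {q : ∀ i, Perm (X i)} {x : ∀ i, X i} {i : ℕ}

theorem act_of_isOpen (h : c.IsOpen i x) : c.act q x i = q i (x i) := if_pos h

theorem act_of_not_isOpen (h : ¬ c.IsOpen i x) : c.act q x i = x i := if_neg h

theorem act_eq_self (h : ∀ i, ¬ c.IsOpen i x) : c.act q x = x :=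
  funext fun i => act_of_not_isOpen (h i)

theorem agree_act (h : c.IsOpen i x) : Agree i (c.act q x) x := fun _ hj =>
  act_of_not_isOpen fun h' => hj.ne (c.eq_of_isOpen h' h)

/-- Only the selected letter changes, and its selection depends on earlier letters alone. This makes
the action multiplicative in `q`. -/
theorem isOpen_act : c.IsOpen i (c.act q x) ↔ c.IsOpen i x := by
  constructor
  · intro h
    by_cases hx : ∃ j, c.IsOpen j x
    · obtain ⟨j, hj⟩ := hx
      rwa [c.eq_of_isOpen h (c.isOpen_of_agree (agree_act (q := q) hj).symm hj)]
    · rwa [act_eq_self (not_exists.1 hx)] at h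
  · exact fun h => c.isOpen_of_agree (agree_act h).symm h

variable (c)

/-- The action of families of permutations on the boundary through a gate. -/
noncomputable def hom : (∀ i, Perm (X i)) →* Perm (∀ i, X i) :=
  MonoidHom.toHomPerm
    { toFun := fun q => (c.act q : Function.End (∀ i, X i))
      map_one' := by
        funext x i
        change c.act 1 x i = x i
        by_cases h : c.IsOpen i x
        · rw [act_of_isOpen h]; rfl
        · rw [act_of_not_isOpen h]
      map_mul' := fun q r => by
        funext x i
        change c.act (q * r) x i = c.act q (c.act r x) i
        by_cases h : c.IsOpen i x
        · rw [act_of_isOpen h, act_of_isOpen (isOpen_act.2 h), act_of_isOpen h]; rfl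
        · rw [act_of_not_isOpen h, act_of_not_isOpen (mt isOpen_act.1 h), act_of_not_isOpen h] }

theorem hom_apply (q : ∀ i, Perm (X i)) (x : ∀ i, X i) : c.hom q x = c.act q x := rfl

theorem hom_mem_levelPreserving (q : ∀ i, Perm (X i)) : c.hom q ∈ levelPreserving X := by
  have key : ∀ (q : ∀ i, Perm (X i)) n x y, Agree n x y → Agree n (c.hom q x) (c.hom q y) := by
    intro q n x y h i hi
    have hi' : Agree i x y := h.mono hi.le
    rw [hom_apply, hom_apply]
    by_cases ho : c.IsOpen i x
    · rw [act_of_isOpen ho, act_of_isOpen (c.isOpen_of_agree hi' ho), h i hi]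
    · rw [act_of_not_isOpen ho,
        act_of_not_isOpen (fun h' => ho (c.isOpen_of_agree hi'.symm h')), h i hi]
  refine fun n x y => ⟨fun h => ?_, key q n x y⟩
  simpa [map_inv] using key q⁻¹ n _ _ h

theorem hom_mem_supportedOn {C : Set (∀ i, X i)} (h : ∀ i x, c.IsOpen i x → x ∈ C)
    (q : ∀ i, Perm (X i)) : c.hom q ∈ supportedOn C := fun x hx =>
  act_eq_self fun i hi => hx (h i x hi)

/-- Conjugation by a permutation `s` that does not touch the selected letter and carries the
gate `c` to the gate `d`. -/
theorem conj_hom {c d : Gate X} {n : ℕ} (hc : ∀ i x, c.IsOpen i x → n ≤ i) {s : Perm (∀ i, X i)}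
    (hs : ∀ x i, n ≤ i → s x i = x i) (hs' : ∀ x y, Agree n x y → Agree n (s x) (s y))
    (hcd : ∀ i x, d.IsOpen i (s x) ↔ c.IsOpen i x) (q : ∀ i, Perm (X i)) :
    s * c.hom q * s⁻¹ = d.hom q := by
  rw [mul_inv_eq_iff_eq_mul]
  ext1 x
  rw [Perm.mul_apply, Perm.mul_apply, hom_apply, hom_apply]
  funext i
  rcases lt_or_ge i n with hi | hi
  · have h1 : Agree n (c.act q x) x := fun _ hj => act_of_not_isOpen fun h => by
      have := hc _ x h; omega
    rw [hs' _ _ h1 i hi, act_of_not_isOpen]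
    rw [hcd]
    exact fun h => absurd (hc i x h) (by omega)
  · rw [hs _ i hi]
    by_cases h : c.IsOpen i x
    · rw [act_of_isOpen h, act_of_isOpen ((hcd i x).2 h), hs _ i hi]
    · rw [act_of_not_isOpen h, act_of_not_isOpen (mt (hcd i x).1 h), hs _ i hi]

end Gate

/-- The gate selecting the `n`-th letter of the points of `cone w n`. -/
def rootedGate (w : ∀ i, X i) (n : ℕ) : Gate X where
  IsOpen i x := i = n ∧ Agree n x w
  isOpen_of_agree := by
    rintro i x y h ⟨rfl, hx⟩
    exact ⟨rfl, h.symm.trans hx⟩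
  eq_of_isOpen h h' := h.1.trans h'.1.symm

/-- For a point of `cone w n` whose first letter after the first `n` letters that differs from the
corresponding letter of `o` is a letter of `e`, the gate selecting the letter after that one. -/
def directedGate (o e w : ∀ i, X i) (n : ℕ) : Gate X where
  IsOpen i x := Agree n x w ∧ ∃ k, i = k + 1 ∧ n ≤ k ∧ (∀ j, n ≤ j → j < k → x j = o j) ∧
    x k = e k ∧ e k ≠ o k
  isOpen_of_agree := by
    rintro i x y h ⟨hx, k, rfl, hnk, hk, hke, hne⟩
    refine ⟨(h.mono (by omega)).symm.trans hx, k, rfl, hnk, fun j hj hjk => ?_, ?_, hne⟩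
    · rw [← h j (by omega), hk j hj hjk]
    · rw [← h k (by omega), hke]
  eq_of_isOpen := by
    rintro i j x ⟨-, k, rfl, hnk, hk, hke, hne⟩ ⟨-, l, rfl, hnl, hl, hle, hne'⟩
    rcases lt_trichotomy k l with h | h | h
    · exact absurd (hke.symm.trans (hl k hnk h)) hne
    · rw [h]
    · exact absurd (hle.symm.trans (hk l hnl h)) hne'

/-- The automorphism that permutes the children of the vertex of level `n` on the path to `w`. -/
noncomputable def rooted (w : ∀ i, X i) (n : ℕ) : (∀ i, Perm (X i)) →* Perm (∀ i, X i) :=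
  (rootedGate w n).hom

/-- The directed automorphism below the vertex of level `n` on the path to `w`, with spine `o`. -/
noncomputable def directed (o e w : ∀ i, X i) (n : ℕ) :
    (∀ i, Perm (X i)) →* Perm (∀ i, X i) := (directedGate o e w n).hom

theorem rooted_mem_levelPreserving (w : ∀ i, X i) (n : ℕ) (q : ∀ i, Perm (X i)) :
    rooted w n q ∈ levelPreserving X := Gate.hom_mem_levelPreserving _ q

theorem directed_mem_levelPreserving (o e w : ∀ i, X i) (n : ℕ) (q : ∀ i, Perm (X i)) :
    directed o e w n q ∈ levelPreserving X := Gate.hom_mem_levelPreserving _ q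

theorem rooted_mem_supportedOn (w : ∀ i, X i) (n : ℕ) (q : ∀ i, Perm (X i)) :
    rooted w n q ∈ supportedOn (cone w n) :=
  Gate.hom_mem_supportedOn (rootedGate w n) (fun _ _ h => h.2) q

theorem directed_mem_supportedOn (o e w : ∀ i, X i) (n : ℕ) (q : ∀ i, Perm (X i)) :
    directed o e w n q ∈ supportedOn (cone w n) :=
  Gate.hom_mem_supportedOn (directedGate o e w n) (fun _ _ h => h.1) q

theorem rooted_apply_of_agree {w x : ∀ i, X i} {n : ℕ} (h : Agree n x w)
    (q : ∀ i, Perm (X i)) : rooted w n q x = Function.update x n (q n (x n)) := by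
  funext i
  by_cases hi : i = n
  · subst hi
    rw [Function.update_self]
    exact Gate.act_of_isOpen ⟨rfl, h⟩
  · rw [Function.update_of_ne hi]
    exact Gate.act_of_not_isOpen fun h' => hi h'.1

theorem rooted_congr {w w' : ∀ i, X i} {n : ℕ} (h : Agree n w w') : rooted w n = rooted w' n := by
  have : rootedGate w n = rootedGate w' n := by
    simp only [rootedGate, Gate.mk.injEq]
    funext i x
    exact propext (and_congr_right fun _ => ⟨fun hx => hx.trans h, fun hx => hx.trans h.symm⟩)
  rw [rooted, rooted, this]

theorem directed_congr (o e : ∀ i, X i) {w w' : ∀ i, X i} {n : ℕ} (h : Agree n w w') :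
    directed o e w n = directed o e w' n := by
  have : directedGate o e w n = directedGate o e w' n := by
    simp only [directedGate, Gate.mk.injEq]
    funext i x
    exact propext (and_congr_left fun _ => ⟨fun hx => hx.trans h, fun hx => hx.trans h.symm⟩)
  rw [directed, directed, this]

/-- The permutations of the boundary that act only on the first `n` letters. -/
def shallow (X : ℕ → Type) (n : ℕ) : Subgroup (Perm (∀ i, X i)) where
  carrier := {s | (∀ x i, n ≤ i → s x i = x i) ∧ ∀ x y, Agree n (s x) (s y) ↔ Agree n x y}
  one_mem' := ⟨fun _ _ _ => rfl, fun _ _ => Iff.rfl⟩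
  mul_mem' {s t} hs ht := ⟨fun x i hi => (hs.1 (t x) i hi).trans (ht.1 x i hi),
    fun x y => (hs.2 _ _).trans (ht.2 x y)⟩
  inv_mem' {s} hs := ⟨fun x i hi => by simpa using (hs.1 (s⁻¹ x) i hi).symm,
    fun x y => by simpa using (hs.2 (s⁻¹ x) (s⁻¹ y)).symm⟩

theorem shallow_le_succ (n : ℕ) : shallow X n ≤ shallow X (n + 1) := by
  rintro s ⟨hs, hs'⟩
  refine ⟨fun x i hi => hs x i (by omega), fun x y => ⟨fun h => ?_, fun h => ?_⟩⟩
  · refine ((hs' x y).1 (h.mono n.le_succ)).succ ?_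
    have := h n n.lt_succ_self
    rwa [hs x n le_rfl, hs y n le_rfl] at this
  · refine ((hs' x y).2 (h.mono n.le_succ)).succ ?_
    rw [hs x n le_rfl, hs y n le_rfl, h n n.lt_succ_self]

theorem rooted_mem_shallow (w : ∀ i, X i) (n : ℕ) (q : ∀ i, Perm (X i)) :
    rooted w n q ∈ shallow X (n + 1) :=
  ⟨fun _ i hi => Gate.act_of_not_isOpen fun h => by have := h.1; omega,
    rooted_mem_levelPreserving w n q (n + 1)⟩

theorem conj_rooted {n : ℕ} {s : Perm (∀ i, X i)} (hs : s ∈ shallow X n) (w : ∀ i, X i)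
    (q : ∀ i, Perm (X i)) : s * rooted w n q * s⁻¹ = rooted (s w) n q :=
  Gate.conj_hom (c := rootedGate w n) (d := rootedGate (s w) n) (n := n) (fun _ _ h => h.1.ge) hs.1 (fun x y => (hs.2 x y).2)
    (fun _ x => and_congr_right fun _ => hs.2 x w) q

theorem conj_directed (o e : ∀ i, X i) {n : ℕ} {s : Perm (∀ i, X i)} (hs : s ∈ shallow X n)
    (w : ∀ i, X i) (q : ∀ i, Perm (X i)) :
    s * directed o e w n q * s⁻¹ = directed o e (s w) n q := by
  refine Gate.conj_hom (c := directedGate o e w n) (d := directedGate o e (s w) n) (n := n) (fun i _ h => ?_) hs.1 (fun x y => (hs.2 x y).2)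
    (fun i x => and_congr (hs.2 x w) (exists_congr fun k => and_congr_right fun _ =>
      and_congr_right fun hk => ?_)) q
  · obtain ⟨-, k, rfl, hk, -⟩ := h
    omega
  · rw [hs.1 x k hk]
    refine and_congr_left fun _ => forall_congr' fun j => forall_congr' fun hj => ?_
    rw [hs.1 x j hj]

/-- The self-similarity behind everything below: at the child `o n` the exit from the spine is still
to come, at the child `e n` it has just happened, and other children are not affected. -/
theorem directed_eq_mul {o e : ∀ i, X i} (w : ∀ i, X i) (n : ℕ) (hoe : e n ≠ o n)
    (q : ∀ i, Perm (X i)) :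
    directed o e w n q = directed o e (Function.update w n (o n)) (n + 1) q *
      rooted (Function.update w n (e n)) (n + 1) q := by
  ext1 x
  rw [Perm.mul_apply]
  by_cases he : Agree (n + 1) x (Function.update w n (e n))
  · have hx := agree_succ_update.1 he
    have ho : rooted (Function.update w n (e n)) (n + 1) q x ∉
        cone (Function.update w n (o n)) (n + 1) := fun h => by
      have h1 := (agree_succ_update.1 h).2
      rw [rooted_apply_of_agree he, Function.update_of_ne (by omega), hx.2] at h1
      exact hoe h1
    rw [directed_mem_supportedOn o e _ _ q _ ho, rooted_apply_of_agree he]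
    have hopen : (directedGate o e w n).IsOpen (n + 1) x :=
      ⟨hx.1, n, rfl, le_rfl, fun j h1 h2 => by omega, hx.2, hoe⟩
    funext i
    by_cases hi : i = n + 1
    · subst hi
      rw [Function.update_self]
      exact Gate.act_of_isOpen hopen
    · rw [Function.update_of_ne hi]
      exact Gate.act_of_not_isOpen fun h => hi (Gate.eq_of_isOpen _ h hopen)
  · rw [rooted_mem_supportedOn _ _ q x he]
    have hiff : ∀ i, (directedGate o e w n).IsOpen i x ↔
        (directedGate o e (Function.update w n (o n)) (n + 1)).IsOpen i x := by
      intro i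
      constructor
      · rintro ⟨hw, k, rfl, hnk, hk, hke, hne⟩
        rcases hnk.eq_or_lt with rfl | hlt
        · exact absurd (agree_succ_update.2 ⟨hw, hke⟩) he
        · exact ⟨agree_succ_update.2 ⟨hw, hk n le_rfl hlt⟩, k, rfl, hlt,
            fun j hj => hk j (by omega), hke, hne⟩
      · rintro ⟨hw, k, rfl, hnk, hk, hke, hne⟩
        obtain ⟨hw, hxn⟩ := agree_succ_update.1 hw
        refine ⟨hw, k, rfl, by omega, fun j hj hjk => ?_, hke, hne⟩
        rcases hj.eq_or_lt with rfl | hj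
        exacts [hxn, hk j hj hjk]
    funext i
    change Gate.act _ q x i = Gate.act _ q x i
    by_cases h : (directedGate o e w n).IsOpen i x
    · rw [Gate.act_of_isOpen h, Gate.act_of_isOpen ((hiff i).1 h)]
    · rw [Gate.act_of_not_isOpen h, Gate.act_of_not_isOpen (mt (hiff i).2 h)]

end BoundaryAction

/-! ### Vertex groups and their commutators. -/

open scoped commutatorElement in
theorem GroupLemmas.commutatorElement_mul_mul {Γ : Type*} [Group Γ] {h k h' k' : Γ}
    (h1 : Commute h' k) (h2 : Commute k' h) (h3 : Commute h' k') :
    ⁅h * h', k * k'⁆ = ⁅h, k⁆ := by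
  have e1 : h * h' * (k * k') = h * k * (h' * k') := by
    rw [mul_assoc, ← mul_assoc h' k k', h1.eq]; simp only [mul_assoc]
  have e2 : k * k' * (h * h') = k * h * (h' * k') := by
    rw [mul_assoc, ← mul_assoc k' h h', h2.eq, h3.eq]; simp only [mul_assoc]
  have e3 : ∀ x y : Γ, ⁅x, y⁆ = x * y * (y * x)⁻¹ := fun x y => by
    rw [commutatorElement_def, mul_inv_rev, mul_assoc (x * y)]
  rw [e3, e3, e1, e2, mul_inv_rev, mul_assoc, mul_inv_cancel_left]

theorem Equiv.Perm.exists_apply_eq_and {α : Type*} {x y a b : α} (hxy : x ≠ y) (hab : a ≠ b) :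
    ∃ π : Equiv.Perm α, π x = a ∧ π y = b := by
  classical
  refine ⟨Equiv.swap (Equiv.swap x a y) b * Equiv.swap x a, ?_, by simp⟩
  rw [Equiv.Perm.mul_apply, Equiv.swap_apply_left, Equiv.swap_apply_of_ne_of_ne _ hab]
  exact fun h => hxy ((Equiv.swap x a).injective ((Equiv.swap_apply_left x a).trans h))

namespace BoundaryAction

open Equiv

variable {X : ℕ → Type}

theorem apply_mem_iff_of_supportedOn {Y : Type*} {C : Set Y} {f : Perm Y}
    (hf : f ∈ supportedOn C) (x : Y) : f x ∈ C ↔ x ∈ C := by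
  constructor
  · intro h
    by_contra hx
    exact hx (hf x hx ▸ h)
  · intro h
    by_contra hx
    exact hx ((f.injective (hf _ hx)).symm ▸ h)

theorem rooted_mulSingle (w : ∀ i, X i) (n : ℕ) (q : ∀ i, Perm (X i)) :
    rooted w n (Pi.mulSingle n (q n)) = rooted w n q := by
  ext1 x
  by_cases hx : Agree n x w
  · rw [rooted_apply_of_agree hx, rooted_apply_of_agree hx, Pi.mulSingle_eq_same]
  · rw [rooted_mem_supportedOn w n _ x hx, rooted_mem_supportedOn w n _ x hx]

theorem rooted_eq_of_apply_eq (w : ∀ i, X i) {n : ℕ} {q r : ∀ i, Perm (X i)} (h : q n = r n) :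
    rooted w n q = rooted w n r := by
  rw [← rooted_mulSingle, h, rooted_mulSingle]

theorem rooted_apply_update (w : ∀ i, X i) (n : ℕ) (q : ∀ i, Perm (X i)) (a : X n) :
    rooted w n q (Function.update w n a) = Function.update w n (q n a) := by
  rw [rooted_apply_of_agree (agree_update n w a), Function.update_self, Function.update_idem]

/-- Conjugation by a rooted element moves the two active children to any two prescribed places. -/
theorem conj_directed_eq_mul {o e : ∀ i, X i} (w : ∀ i, X i) (n : ℕ) (hoe : e n ≠ o n)
    (q r : ∀ i, Perm (X i)) :
    rooted w n r * directed o e w n q * (rooted w n r)⁻¹ =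
      directed o e (Function.update w n (r n (o n))) (n + 1) q *
      rooted (Function.update w n (r n (e n))) (n + 1) q := by
  rw [directed_eq_mul w n hoe, ← rooted_apply_update, ← rooted_apply_update,
    ← conj_directed o e (rooted_mem_shallow w n r), ← conj_rooted (rooted_mem_shallow w n r)]
  group

/-- The group generated by the rooted and the directed automorphisms of the subtree below the
vertex of level `n` on the path to `w`. -/
noncomputable def vertexGroup (o e : ∀ i, X i) (B : Subgroup (∀ i, Perm (X i))) (w : ∀ i, X i)
    (n : ℕ) : Subgroup (Perm (∀ i, X i)) :=
  (rooted w n).range ⊔ B.map (directed o e w n)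

section vertexGroup

variable {o e : ∀ i, X i} {B : Subgroup (∀ i, Perm (X i))} {w : ∀ i, X i} {n : ℕ}

theorem rooted_mem_vertexGroup (q : ∀ i, Perm (X i)) : rooted w n q ∈ vertexGroup o e B w n :=
  Subgroup.mem_sup_left ⟨q, rfl⟩

theorem directed_mem_vertexGroup {b : ∀ i, Perm (X i)} (hb : b ∈ B) :
    directed o e w n b ∈ vertexGroup o e B w n :=
  Subgroup.mem_sup_right ⟨b, hb, rfl⟩

theorem vertexGroup_le {K : Subgroup (Perm (∀ i, X i))} (h1 : ∀ q, rooted w n q ∈ K)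
    (h2 : ∀ b ∈ B, directed o e w n b ∈ K) : vertexGroup o e B w n ≤ K := by
  refine sup_le ?_ ?_
  · rintro _ ⟨q, rfl⟩
    exact h1 q
  · rintro _ ⟨b, hb, rfl⟩
    exact h2 b hb

theorem vertexGroup_congr {w' : ∀ i, X i} (h : Agree n w w') :
    vertexGroup o e B w n = vertexGroup o e B w' n := by
  rw [vertexGroup, vertexGroup, rooted_congr h, directed_congr o e h]

theorem vertexGroup_mono {M : Subgroup (∀ i, Perm (X i))} (h : M ≤ B) :
    vertexGroup o e M w n ≤ vertexGroup o e B w n :=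
  sup_le_sup_left (Subgroup.map_mono h) _

theorem vertexGroup_sup (M N : Subgroup (∀ i, Perm (X i))) :
    vertexGroup o e (M ⊔ N) w n = vertexGroup o e M w n ⊔ vertexGroup o e N w n := by
  rw [vertexGroup, vertexGroup, vertexGroup, Subgroup.map_sup, sup_sup_distrib_left]

theorem vertexGroup_le_levelPreserving : vertexGroup o e B w n ≤ levelPreserving X :=
  vertexGroup_le (rooted_mem_levelPreserving w n)
    fun b _ => directed_mem_levelPreserving o e w n b

theorem vertexGroup_le_supportedOn : vertexGroup o e B w n ≤ supportedOn (cone w n) :=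
  vertexGroup_le (rooted_mem_supportedOn w n) fun b _ => directed_mem_supportedOn o e w n b

theorem conj_mem_vertexGroup {s : Perm (∀ i, X i)} (hs : s ∈ shallow X n) {g : Perm (∀ i, X i)}
    (hg : g ∈ vertexGroup o e B w n) : s * g * s⁻¹ ∈ vertexGroup o e B (s w) n := by
  have : vertexGroup o e B w n ≤
      (vertexGroup o e B (s w) n).comap (MulAut.conj s).toMonoidHom := by
    refine vertexGroup_le (fun q => ?_) fun b hb => ?_
    · change s * rooted w n q * s⁻¹ ∈ vertexGroup o e B (s w) n
      rw [conj_rooted hs]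
      exact rooted_mem_vertexGroup q
    · change s * directed o e w n b * s⁻¹ ∈ vertexGroup o e B (s w) n
      rw [conj_directed o e hs]
      exact directed_mem_vertexGroup hb
  exact this hg

/-- Every element of the group of the child `a` extends, by an element supported below another
child `b`, to an element of the group of the parent vertex. -/
theorem exists_mul_mem_vertexGroup (hoe : e n ≠ o n) (hB : ∀ i (π : Perm (X i)), ∃ b ∈ B, b i = π)
    {a b : X n} (hab : a ≠ b) {h : Perm (∀ i, X i)}
    (hh : h ∈ vertexGroup o e B (Function.update w n a) (n + 1)) :
    ∃ h' ∈ supportedOn (cone (Function.update w n b) (n + 1)), h * h' ∈ vertexGroup o e B w n := by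
  have hcomm : ∀ {f g : Perm (∀ i, X i)},
      f ∈ supportedOn (cone (Function.update w n a) (n + 1)) →
      g ∈ supportedOn (cone (Function.update w n b) (n + 1)) → Commute f g := fun hf hg =>
    commute_of_supportedOn (disjoint_cone_update w n hab) hf hg
  -- The extendable elements form a subgroup because factors below `a` commute with factors below
  -- `b`; only generators remain to be checked.
  let L : Subgroup (Perm (∀ i, X i)) :=
    { carrier := {h | h ∈ supportedOn (cone (Function.update w n a) (n + 1)) ∧
        ∃ h' ∈ supportedOn (cone (Function.update w n b) (n + 1)),
          h * h' ∈ vertexGroup o e B w n}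
      one_mem' := ⟨one_mem _, 1, one_mem _, by simp⟩
      mul_mem' := by
        rintro f g ⟨hf, f', hf', hff⟩ ⟨hg, g', hg', hgg⟩
        refine ⟨mul_mem hf hg, f' * g', mul_mem hf' hg', ?_⟩
        have : f * g * (f' * g') = f * f' * (g * g') := by
          rw [mul_assoc, ← mul_assoc g f' g', (hcomm hg hf').eq]; simp only [mul_assoc]
        rw [this]
        exact mul_mem hff hgg
      inv_mem' := by
        rintro f ⟨hf, f', hf', hff⟩
        refine ⟨inv_mem hf, f'⁻¹, inv_mem hf', ?_⟩
        rw [← mul_inv_rev, ← (hcomm hf hf').eq]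
        exact inv_mem hff }
  have hconj : ∀ (π : Perm (X n)) {q : ∀ i, Perm (X i)}, q ∈ B →
      directed o e (Function.update w n (π (o n))) (n + 1) q *
        rooted (Function.update w n (π (e n))) (n + 1) q ∈ vertexGroup o e B w n := by
    intro π q hq
    have := conj_directed_eq_mul w n hoe q (Pi.mulSingle n π)
    rw [Pi.mulSingle_eq_same] at this
    rw [← this]
    exact mul_mem (mul_mem (rooted_mem_vertexGroup _) (directed_mem_vertexGroup hq))
      (inv_mem (rooted_mem_vertexGroup _))
  have hL : vertexGroup o e B (Function.update w n a) (n + 1) ≤ L := by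
    refine vertexGroup_le (fun q => ⟨rooted_mem_supportedOn _ _ _, ?_⟩)
      fun q hq => ⟨directed_mem_supportedOn _ _ _ _ _, ?_⟩
    -- A rooted element at `a` uses only the component `n + 1`, so its family can be replaced by one
    -- in `B`; then `π` carries `e n` to `a` and `o n` to `b`.
    · obtain ⟨q', hq', hqq⟩ := hB (n + 1) (q (n + 1))
      obtain ⟨π, hπ, hπ'⟩ := Perm.exists_apply_eq_and hoe hab
      refine ⟨directed o e (Function.update w n b) (n + 1) q',
        directed_mem_supportedOn _ _ _ _ _, ?_⟩
      rw [(hcomm (rooted_mem_supportedOn _ _ _) (directed_mem_supportedOn _ _ _ _ _)).eq,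
        rooted_eq_of_apply_eq _ hqq.symm]
      simpa only [hπ, hπ'] using hconj π hq'
    · obtain ⟨π, hπ, hπ'⟩ := Perm.exists_apply_eq_and hoe.symm hab
      refine ⟨rooted (Function.update w n b) (n + 1) q, rooted_mem_supportedOn _ _ _, ?_⟩
      simpa only [hπ, hπ'] using hconj π hq
  exact (hL hh).2

/-- Extend two elements of the child's group by factors below two further, distinct children. These
factors drop out of the commutator; this is where three letters are needed. -/
theorem commutator_vertexGroup_succ_le (hoe : e n ≠ o n)
    (hB : ∀ i (π : Perm (X i)), ∃ b ∈ B, b i = π) (h3 : ∀ a b : X n, ∃ c, c ≠ a ∧ c ≠ b) :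
    ⁅vertexGroup o e B w (n + 1), vertexGroup o e B w (n + 1)⁆ ≤
      ⁅vertexGroup o e B w n, vertexGroup o e B w n⁆ := by
  rw [Subgroup.commutator_le]
  intro h hh k hk
  rw [← Function.update_eq_self n w] at hh hk
  obtain ⟨b, hb, -⟩ := h3 (w n) (w n)
  obtain ⟨c, hc, hcb⟩ := h3 (w n) b
  obtain ⟨h', hh', h1⟩ := exists_mul_mem_vertexGroup hoe hB hb.symm hh
  obtain ⟨k', hk', k1⟩ := exists_mul_mem_vertexGroup hoe hB hc.symm hk
  rw [← GroupLemmas.commutatorElement_mul_mul (h' := h') (k' := k')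
    (commute_of_supportedOn (disjoint_cone_update w n hb) hh' (vertexGroup_le_supportedOn hk))
    (commute_of_supportedOn (disjoint_cone_update w n hc) hk' (vertexGroup_le_supportedOn hh))
    (commute_of_supportedOn (disjoint_cone_update w n hcb.symm) hh' hk')]
  exact Subgroup.commutator_mem_commutator h1 k1

theorem commutator_vertexGroup_le (hoe : ∀ n, e n ≠ o n)
    (hB : ∀ i (π : Perm (X i)), ∃ b ∈ B, b i = π) (h3 : ∀ n (a b : X n), ∃ c, c ≠ a ∧ c ≠ b)
    (w : ∀ i, X i) (n : ℕ) :
    ⁅vertexGroup o e B w n, vertexGroup o e B w n⁆ ≤ vertexGroup o e B w 0 := by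
  induction n with
  | zero => exact Subgroup.commutator_le_self _
  | succ n ih =>
    exact (commutator_vertexGroup_succ_le (hoe n) hB (h3 n)).trans ih

end vertexGroup

/-! ### Level groups and finite index. -/

/-- Extend a finite string by the letters of `o`. -/
def extend (o : ∀ i, X i) {n : ℕ} (v : (i : Fin n) → X i) : ∀ i, X i :=
  fun i => if h : i < n then v ⟨i, h⟩ else o i

/-- The first `n` letters of a boundary point. -/
def truncate (n : ℕ) (x : ∀ i, X i) : (i : Fin n) → X i := fun i => x i

theorem truncate_extend (o : ∀ i, X i) {n : ℕ} (v : (i : Fin n) → X i) :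
    truncate n (extend o v) = v := funext fun i => dif_pos i.2

theorem truncate_eq_iff {n : ℕ} {x y : ∀ i, X i} : truncate n x = truncate n y ↔ Agree n x y :=
  ⟨fun h i hi => congrFun h ⟨i, hi⟩, fun h => funext fun i => h i i.2⟩

theorem agree_extend_truncate (o : ∀ i, X i) (n : ℕ) (x : ∀ i, X i) :
    Agree n (extend o (truncate n x)) x := truncate_eq_iff.1 (truncate_extend o _)

/-- The group generated by the vertex groups of level `n`. -/
noncomputable def levelGroup (o e : ∀ i, X i) (B : Subgroup (∀ i, Perm (X i))) (n : ℕ) :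
    Subgroup (Perm (∀ i, X i)) :=
  ⨆ v : (i : Fin n) → X i, vertexGroup o e B (extend o v) n

/-- The permutations of the boundary that fix the vertices of level `n`. -/
def levelStabilizer (X : ℕ → Type) (n : ℕ) : Subgroup (Perm (∀ i, X i)) where
  carrier := {g | ∀ x, Agree n (g x) x}
  one_mem' x := Agree.refl n x
  mul_mem' {f g} hf hg x := (hf (g x)).trans (hg x)
  inv_mem' {f} hf x := by simpa using (hf (f⁻¹ x)).symm

section levelGroup

variable {o e : ∀ i, X i} {B : Subgroup (∀ i, Perm (X i))} {w : ∀ i, X i} {n : ℕ}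

theorem vertexGroup_le_levelGroup : vertexGroup o e B w n ≤ levelGroup o e B n := by
  rw [← vertexGroup_congr (agree_extend_truncate o n w)]
  exact le_iSup (fun v : (i : Fin n) → X i => vertexGroup o e B (extend o v) n) (truncate n w)

theorem levelGroup_le_levelStabilizer : levelGroup o e B n ≤ levelStabilizer X n := by
  refine iSup_le fun v g hg x => ?_
  have hg := vertexGroup_le_supportedOn hg
  by_cases hx : x ∈ cone (extend o v) n
  · exact Agree.trans ((apply_mem_iff_of_supportedOn hg x).2 hx) (Agree.symm hx)
  · rw [hg x hx]
    exact Agree.refl n x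

theorem shallow_le_normalizer_levelGroup :
    shallow X n ≤ Subgroup.normalizer (levelGroup o e B n) := by
  have key : ∀ s ∈ shallow X n, ∀ g ∈ levelGroup o e B n, s * g * s⁻¹ ∈ levelGroup o e B n := by
    intro s hs g hg
    have : levelGroup o e B n ≤ (levelGroup o e B n).comap (MulAut.conj s).toMonoidHom :=
      iSup_le fun v g hg => vertexGroup_le_levelGroup (conj_mem_vertexGroup hs hg)
    exact this hg
  intro s hs
  rw [Subgroup.mem_normalizer_iff]
  intro g
  refine ⟨key s hs g, fun h => ?_⟩
  simpa [mul_assoc] using key s⁻¹ (inv_mem hs) _ h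

theorem shallow_inf_levelStabilizer {s : Perm (∀ i, X i)} (hs : s ∈ shallow X n)
    (hs' : s ∈ levelStabilizer X n) : s = 1 := by
  ext1 x
  funext i
  rcases lt_or_ge i n with h | h
  exacts [hs' x i h, hs.1 x i h]

/-- Repeated use of `directed_eq_mul` pushes directed elements down to level `n`; the rooted
elements of earlier levels are shallow. -/
theorem vertexGroup_zero_le (hoe : ∀ n, e n ≠ o n) (n : ℕ) :
    vertexGroup o e B w 0 ≤ levelGroup o e B n ⊔ shallow X n := by
  induction n with
  | zero => exact vertexGroup_le_levelGroup.trans le_sup_left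
  | succ n ih =>
    refine ih.trans (sup_le (iSup_le fun v => vertexGroup_le (fun q => ?_) fun b hb => ?_)
      ((shallow_le_succ n).trans le_sup_right))
    · exact Subgroup.mem_sup_right (rooted_mem_shallow _ n q)
    · rw [directed_eq_mul _ n (hoe n)]
      exact Subgroup.mem_sup_left (mul_mem
        (vertexGroup_le_levelGroup (directed_mem_vertexGroup hb))
        (vertexGroup_le_levelGroup (rooted_mem_vertexGroup b)))

/-- Since shallow elements normalize the level group, an element is a shallow one times one of the
level group. Fixing level `n` forces the shallow factor to be trivial. -/
theorem vertexGroup_inf_levelStabilizer_le (hoe : ∀ n, e n ≠ o n) (n : ℕ) :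
    vertexGroup o e B w 0 ⊓ levelStabilizer X n ≤ levelGroup o e B n := by
  rintro g ⟨hg, hgn⟩
  have hg := vertexGroup_zero_le hoe n hg
  rw [← SetLike.mem_coe, sup_comm, Subgroup.coe_mul_of_left_le_normalizer_right _ _
    shallow_le_normalizer_levelGroup] at hg
  obtain ⟨s, hs, p, hp, rfl⟩ := hg
  have : s = 1 := shallow_inf_levelStabilizer hs
    ((Subgroup.mul_mem_cancel_right _ (levelGroup_le_levelStabilizer hp)).1 hgn)
  subst this
  simpa using hp

theorem commutator_levelGroup_le [∀ i, Finite (X i)] :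
    ⁅levelGroup o e B n, levelGroup o e B n⁆ ≤ ⨆ v : (i : Fin n) → X i,
      ⁅vertexGroup o e B (extend o v) n, vertexGroup o e B (extend o v) n⁆ := by
  refine GroupLemmas.commutator_iSup_le _ fun u v huv x y hx hy =>
    commute_of_supportedOn (disjoint_cone fun h => huv ?_)
      (vertexGroup_le_supportedOn hx) (vertexGroup_le_supportedOn hy)
  simpa only [truncate_extend] using truncate_eq_iff.2 h

/-- The rooted automorphisms at a vertex together with the directed ones coming from `T`. -/
def vertexGenerators (o e : ∀ i, X i) (T : Set (∀ i, Perm (X i))) (w : ∀ i, X i) (n : ℕ) :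
    Set (Perm (∀ i, X i)) :=
  Set.range (fun π : Perm (X n) => rooted w n (Pi.mulSingle n π)) ∪ directed o e w n '' T

theorem closure_vertexGenerators (T : Set (∀ i, Perm (X i))) :
    Subgroup.closure (vertexGenerators o e T w n) =
      vertexGroup o e (Subgroup.closure T) w n := by
  have : Set.range (fun π : Perm (X n) => rooted w n (Pi.mulSingle n π)) =
      (rooted w n).range := by
    ext g
    constructor
    · rintro ⟨π, rfl⟩
      exact ⟨_, rfl⟩
    · rintro ⟨q, rfl⟩
      exact ⟨q n, rooted_mulSingle w n q⟩
  rw [vertexGenerators, Subgroup.closure_union, this, Subgroup.closure_eq, vertexGroup,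
    MonoidHom.map_closure]

theorem finite_vertexGenerators [∀ i, Finite (X i)] {T : Set (∀ i, Perm (X i))} (hT : T.Finite) :
    (vertexGenerators o e T w n).Finite :=
  (Set.finite_range _).union (hT.image _)

theorem isOfFinOrder_of_mem_vertexGenerators [∀ i, Finite (X i)] {T : Set (∀ i, Perm (X i))}
    (hT : ∀ t ∈ T, IsOfFinOrder t) {g : Perm (∀ i, X i)} (hg : g ∈ vertexGenerators o e T w n) :
    IsOfFinOrder g := by
  rcases hg with ⟨π, rfl⟩ | ⟨t, ht, rfl⟩
  · exact (rooted w n).isOfFinOrder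
      ((MonoidHom.mulSingle (fun i => Perm (X i)) n).isOfFinOrder (isOfFinOrder_of_finite π))
  · exact (directed o e w n).isOfFinOrder (hT t ht)

theorem relIndex_levelGroup_ne_zero [∀ i, Finite (X i)] {T : Set (∀ i, Perm (X i))}
    (hT : T.Finite) (hT' : ∀ t ∈ T, IsOfFinOrder t) :
    (⨆ v : (i : Fin n) → X i, ⁅vertexGroup o e (Subgroup.closure T) (extend o v) n,
      vertexGroup o e (Subgroup.closure T) (extend o v) n⁆).relIndex
      (levelGroup o e (Subgroup.closure T) n) ≠ 0 := by
  have hcl : Subgroup.closure (⋃ v : (i : Fin n) → X i, vertexGenerators o e T (extend o v) n) =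
      levelGroup o e (Subgroup.closure T) n := by
    rw [Subgroup.closure_iUnion]
    simp only [closure_vertexGenerators, levelGroup]
  rw [← hcl]
  refine GroupLemmas.relIndex_ne_zero_of_commutator_le
    (Set.finite_iUnion fun v => finite_vertexGenerators hT) ?_ ?_
  · intro g hg
    obtain ⟨v, hv⟩ := Set.mem_iUnion.1 hg
    exact isOfFinOrder_of_mem_vertexGenerators hT' hv
  · rw [hcl]
    exact commutator_levelGroup_le

end levelGroup

end BoundaryAction

/-! ### Transitivity on layers, and germs along the spine. -/

namespace BoundaryAction

open Equiv

variable {X : ℕ → Type}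

section transitivity

variable {o e : ∀ i, X i} {B : Subgroup (∀ i, Perm (X i))} {w : ∀ i, X i}

theorem exists_agree_apply (hoe : ∀ n, e n ≠ o n)
    (hB : ∀ i (π : Perm (X i)), ∃ b ∈ B, b i = π) (n : ℕ) (x y : ∀ i, X i) :
    ∃ g ∈ vertexGroup o e B w 0, Agree n (g x) y := by
  classical
  induction n generalizing x y with
  | zero => exact ⟨1, one_mem _, fun i hi => absurd hi i.not_lt_zero⟩
  | succ n ih =>
    rcases n with _ | m
    · refine ⟨rooted w 0 (Pi.mulSingle 0 (swap (x 0) (y 0))), rooted_mem_vertexGroup _,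
        fun i hi => ?_⟩
      obtain rfl : i = 0 := by omega
      rw [rooted_apply_of_agree (fun i hi => absurd hi i.not_lt_zero), Function.update_self,
        Pi.mulSingle_eq_same, swap_apply_left]
    -- Both points are moved to the vertex `o … o e` of level `m + 1`, where a directed element
    -- induces any given permutation of the next letter.
    · obtain ⟨g, hg, hgx⟩ := ih x (Function.update o m (e m))
      obtain ⟨h, hh, hhy⟩ := ih y (Function.update o m (e m))
      obtain ⟨b, hb, hbm⟩ := hB (m + 1) (swap (g x (m + 1)) (h y (m + 1)))
      have hopen : (directedGate o e w 0).IsOpen (m + 1) (g x) := by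
        obtain ⟨h1, h2⟩ := agree_succ_update.1 hgx
        exact ⟨fun i hi => absurd hi i.not_lt_zero, m, rfl, m.zero_le, fun j _ hj => h1 j hj,
          h2, hoe m⟩
      refine ⟨h⁻¹ * directed o e w 0 b * g,
        mul_mem (mul_mem (inv_mem hh) (directed_mem_vertexGroup hb)) hg, ?_⟩
      refine (vertexGroup_le_levelPreserving hh _ _ _).1 ?_
      have hcancel : h ((h⁻¹ * directed o e w 0 b * g) x) = directed o e w 0 b (g x) := by simp
      rw [hcancel]
      refine Agree.succ (((Gate.agree_act hopen).trans hgx).trans hhy.symm) ?_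
      refine (Gate.act_of_isOpen hopen).trans ?_
      rw [hbm, swap_apply_left]

end transitivity

section germs

variable {o e : ∀ i, X i}

/-- Near `ξ` the permutation `g` replaces the first `n` letters by those of `η` and acts on the
remaining letters as the directed automorphism given by `a`; both `ξ` and `η` continue with the
letters of `o`. -/
def HasGerm (o e : ∀ i, X i) (g : Perm (∀ i, X i)) (ξ η : ∀ i, X i) (n : ℕ)
    (a : ∀ i, Perm (X i)) : Prop :=
  (∀ i, n ≤ i → ξ i = o i) ∧ (∀ i, n ≤ i → η i = o i) ∧
    ∀ x, Agree n x ξ → Agree n (g x) η ∧ ∀ i, n ≤ i → g x i = directed o e x n a x i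

theorem directedGate_isOpen_iff_of_tail {n : ℕ} {x y : ∀ i, X i} (h : ∀ i, n ≤ i → x i = y i)
    (i : ℕ) : (directedGate o e x n).IsOpen i x ↔ (directedGate o e y n).IsOpen i y := by
  refine and_congr ⟨fun _ => Agree.refl n y, fun _ => Agree.refl n x⟩ (exists_congr fun k =>
    and_congr_right fun _ => and_congr_right fun hk => ?_)
  rw [h k hk]
  refine and_congr_left fun _ => forall_congr' fun j => forall_congr' fun hj => ?_
  rw [h j hj]

theorem directed_apply_of_tail {n : ℕ} {x y : ∀ i, X i} (h : ∀ i, n ≤ i → x i = y i)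
    (a : ∀ i, Perm (X i)) {i : ℕ} (hi : n ≤ i) :
    directed o e x n a x i = directed o e y n a y i := by
  change Gate.act _ a x i = Gate.act _ a y i
  by_cases hx : (directedGate o e x n).IsOpen i x
  · rw [Gate.act_of_isOpen hx,
      Gate.act_of_isOpen ((directedGate_isOpen_iff_of_tail h i).1 hx), h i hi]
  · rw [Gate.act_of_not_isOpen hx,
      Gate.act_of_not_isOpen (mt (directedGate_isOpen_iff_of_tail h i).2 hx), h i hi]

theorem agree_directed_apply (w x : ∀ i, X i) (n : ℕ) (a : ∀ i, Perm (X i)) :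
    Agree (n + 1) (directed o e w n a x) x := fun i hi =>
  Gate.act_of_not_isOpen fun ⟨_, k, hk, hnk, _⟩ => by omega

/-- Near `ξ` the letter `n` is `o n`, so of the two factors in `directed_eq_mul` only the directed
one acts, with the same family. -/
theorem HasGerm.succ (hoe : ∀ n, e n ≠ o n) {g : Perm (∀ i, X i)} {ξ η : ∀ i, X i} {n : ℕ}
    {a : ∀ i, Perm (X i)} (h : HasGerm o e g ξ η n a) : HasGerm o e g ξ η (n + 1) a := by
  refine ⟨fun i hi => h.1 i (by omega), fun i hi => h.2.1 i (by omega), fun x hx => ?_⟩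
  obtain ⟨h1, h2⟩ := h.2.2 x (hx.mono n.le_succ)
  have hxn : x n = o n := (hx n n.lt_succ_self).trans (h.1 n le_rfl)
  refine ⟨h1.succ ?_, fun i hi => ?_⟩
  · rw [h2 n le_rfl, agree_directed_apply x x n a n n.lt_succ_self, hxn, h.2.1 n le_rfl]
  · have hupd : Function.update x n (o n) = x := by rw [← hxn, Function.update_eq_self]
    rw [h2 i (by omega), directed_eq_mul x n (hoe n), Perm.mul_apply, hupd,
      rooted_mem_supportedOn _ _ a x]
    exact fun hx' => hoe n ((agree_succ_update.1 hx').2.symm.trans hxn)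

theorem HasGerm.mono (hoe : ∀ n, e n ≠ o n) {g : Perm (∀ i, X i)} {ξ η : ∀ i, X i} {m n : ℕ}
    {a : ∀ i, Perm (X i)} (h : HasGerm o e g ξ η m a) (hmn : m ≤ n) :
    HasGerm o e g ξ η n a := Nat.le_induction h (fun _ _ => HasGerm.succ hoe) n hmn

theorem HasGerm.mul {g h : Perm (∀ i, X i)} {ξ η ζ : ∀ i, X i} {n : ℕ} {a b : ∀ i, Perm (X i)}
    (hh : HasGerm o e h ξ η n b) (hg : HasGerm o e g η ζ n a) :
    HasGerm o e (g * h) ξ ζ n (a * b) := by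
  refine ⟨hh.1, hg.2.1, fun x hx => ?_⟩
  obtain ⟨h1, h2⟩ := hh.2.2 x hx
  obtain ⟨g1, g2⟩ := hg.2.2 (h x) h1
  refine ⟨g1, fun i hi => ?_⟩
  rw [Perm.mul_apply, g2 i hi, map_mul, Perm.mul_apply, directed_apply_of_tail h2 a hi,
    directed_congr o e ((agree_directed_apply x x n b).mono n.le_succ)]

theorem exists_hasGerm_directed (w : ∀ i, X i) (b : ∀ i, Perm (X i)) {ξ : ∀ i, X i} {N : ℕ}
    (hξ : ∀ i, N ≤ i → ξ i = o i) :
    ∃ η n, HasGerm o e (directed o e w 0 b) ξ η n b ∨ HasGerm o e (directed o e w 0 b) ξ η n 1 := by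
  classical
  have hagree : ∀ x y : ∀ i, X i, Agree 0 x y := fun _ _ i hi => absurd hi i.not_lt_zero
  by_cases h : ∃ k, ξ k ≠ o k
  · obtain ⟨k, hk⟩ := h
    -- Once the spine has been left at the letter `k`, no letter beyond `k + 1` can be selected.
    have hnot : ∀ x i, Agree (k + 2) x ξ → k + 2 ≤ i → ¬ (directedGate o e w 0).IsOpen i x := by
      rintro x i hx hi ⟨-, l, rfl, -, hl, -⟩
      exact hk ((hx k (by omega)).symm.trans (hl k k.zero_le (by omega)))
    refine ⟨directed o e w 0 b ξ, max N (k + 2), Or.inr ⟨fun i hi => hξ i (by omega),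
      fun i hi => ?_, fun x hx => ⟨?_, fun i hi => ?_⟩⟩⟩
    · exact (Gate.act_of_not_isOpen (hnot ξ i (Agree.refl _ _) (by omega))).trans
        (hξ i (by omega))
    · exact (directed_mem_levelPreserving o e w 0 b _ _ _).2 hx
    · rw [map_one, Perm.one_apply]
      exact Gate.act_of_not_isOpen (hnot x i (hx.mono (by omega)) (by omega))
  · push Not at h
    refine ⟨ξ, 0, Or.inl ⟨fun i _ => h i, fun i _ => h i, fun x _ => ⟨hagree _ _, fun i _ => ?_⟩⟩⟩
    rw [directed_congr o e (hagree w x)]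

theorem hasGerm_rooted (w : ∀ i, X i) (q : ∀ i, Perm (X i)) {ξ : ∀ i, X i} {N : ℕ}
    (hξ : ∀ i, N ≤ i → ξ i = o i) :
    HasGerm o e (rooted w 0 q) ξ (rooted w 0 q ξ) (N + 1) 1 := by
  have htail : ∀ x i, 1 ≤ i → rooted w 0 q x i = x i := (rooted_mem_shallow w 0 q).1
  refine ⟨fun i hi => hξ i (by omega), fun i hi => ?_, fun x hx => ⟨?_, fun i hi => ?_⟩⟩
  · rw [htail ξ i (by omega), hξ i (by omega)]
  · exact (rooted_mem_levelPreserving w 0 q _ _ _).2 hx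
  · rw [map_one, Perm.one_apply, htail x i (by omega)]

/-- Induction on words: each generator has a germ in `M` at every point cofinal with `o`, its image
is again such a point, and germs multiply after passing to a common level. -/
theorem exists_hasGerm (hoe : ∀ n, e n ≠ o n) {M : Subgroup (∀ i, Perm (X i))} {w : ∀ i, X i}
    {g : Perm (∀ i, X i)} (hg : g ∈ vertexGroup o e M w 0) {ξ : ∀ i, X i} {N : ℕ}
    (hξ : ∀ i, N ≤ i → ξ i = o i) : ∃ η n, ∃ a ∈ M, HasGerm o e g ξ η n a := by
  have hgen : ∀ s ∈ ((rooted w 0).range : Set (Perm (∀ i, X i))) ∪ M.map (directed o e w 0),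
      ∀ ξ : ∀ i, X i, (∃ N, ∀ i, N ≤ i → ξ i = o i) → ∃ η n, ∃ a ∈ M, HasGerm o e s ξ η n a := by
    rintro _ (⟨q, rfl⟩ | ⟨b, hb, rfl⟩) ξ ⟨N, hξ⟩
    · exact ⟨_, _, 1, one_mem _, hasGerm_rooted w q hξ⟩
    · obtain ⟨η, n, h | h⟩ := exists_hasGerm_directed w b hξ
      exacts [⟨η, n, b, hb, h⟩, ⟨η, n, 1, one_mem _, h⟩]
  have hmul : ∀ s h : Perm (∀ i, X i),
      s ∈ ((rooted w 0).range : Set (Perm (∀ i, X i))) ∪ M.map (directed o e w 0) →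
      (∀ ξ : ∀ i, X i, (∃ N, ∀ i, N ≤ i → ξ i = o i) → ∃ η n, ∃ a ∈ M, HasGerm o e h ξ η n a) →
      ∀ ξ : ∀ i, X i, (∃ N, ∀ i, N ≤ i → ξ i = o i) →
        ∃ η n, ∃ a ∈ M, HasGerm o e (s * h) ξ η n a := by
    intro s h hs hh ξ hξ
    obtain ⟨η, m, b, hb, h1⟩ := hh ξ hξ
    obtain ⟨ζ, n, a, ha, h2⟩ := hgen s hs η ⟨m, h1.2.1⟩
    exact ⟨ζ, max m n, a * b, mul_mem ha hb,
      (h1.mono hoe (le_max_left _ _)).mul (h2.mono hoe (le_max_right _ _))⟩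
  rw [vertexGroup, Subgroup.sup_eq_closure] at hg
  suffices h : ∀ ξ : ∀ i, X i, (∃ N, ∀ i, N ≤ i → ξ i = o i) →
      ∃ η n, ∃ a ∈ M, HasGerm o e g ξ η n a from h ξ ⟨N, hξ⟩
  induction hg using Subgroup.closure_induction_left with
  | one =>
    rintro ξ ⟨N, hξ⟩
    have h1 := hasGerm_rooted (e := e) w 1 hξ
    rw [map_one] at h1
    exact ⟨_, _, 1, one_mem M, h1⟩
  | mul_left s hs h _ ih => exact hmul s h hs ih
  | inv_mul_cancel s hs h _ ih =>
    exact hmul s⁻¹ h (hs.imp (fun hs => inv_mem hs) fun hs => inv_mem hs) ih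

/-- A directed automorphism that is generated by the rooted automorphisms and the directed ones
coming from `M` is given by a family that eventually coincides with a member of `M`. -/
theorem eventually_eq_of_directed_mem (hoe : ∀ n, e n ≠ o n) {M : Subgroup (∀ i, Perm (X i))}
    {w : ∀ i, X i} {b : ∀ i, Perm (X i)} (hb : directed o e w 0 b ∈ vertexGroup o e M w 0) :
    ∃ a ∈ M, ∀ᶠ n in Filter.atTop, b n = a n := by
  obtain ⟨η, n, a, ha, h⟩ := exists_hasGerm hoe hb (ξ := o) (N := 0) fun _ _ => rfl
  refine ⟨a, ha, Filter.eventually_atTop.2 ⟨n + 1, fun m hm => ?_⟩⟩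
  obtain ⟨m, rfl⟩ := Nat.exists_eq_add_of_le' (Nat.one_le_of_lt hm)
  ext1 y
  -- At the test point `o … o e y` both descriptions act on the letter `m + 1`, one by `b` and the
  -- other by `a`.
  let x : ∀ i, X i := Function.update (Function.update o m (e m)) (m + 1) y
  have hxo : ∀ i < m, x i = o i := fun i hi => by
    simp only [x]
    rw [Function.update_of_ne (by omega), Function.update_of_ne (by omega)]
  have hxm : x m = e m := by
    simp only [x]
    rw [Function.update_of_ne (by omega), Function.update_self]
  have hxy : x (m + 1) = y := Function.update_self ..
  have h1 := (h.2.2 x fun i hi => hxo i (by omega)).2 (m + 1) (by omega)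
  have hopen : ∀ (w : ∀ i, X i) k, k ≤ m → Agree k x w →
      (directedGate o e w k).IsOpen (m + 1) x := fun w k hk hw =>
    ⟨hw, m, rfl, hk, fun j _ hj => hxo j hj, hxm, hoe m⟩
  have h2 : directed o e w 0 b x (m + 1) = b (m + 1) (x (m + 1)) :=
    Gate.act_of_isOpen (hopen w 0 m.zero_le fun i hi => absurd hi i.not_lt_zero)
  have h3 : directed o e x n a x (m + 1) = a (m + 1) (x (m + 1)) :=
    Gate.act_of_isOpen (hopen x n (by omega) (Agree.refl _ _))
  rw [h2, h3, hxy] at h1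
  exact h1

end germs

end BoundaryAction

/-! ### From boundary permutations to tree automorphisms. -/

namespace BoundaryAction

open Equiv RootedTree

variable {X : ℕ → Type}

/-- The action of boundary permutations on the vertices of level `n`. -/
def layerPerm (o : ∀ i, X i) (n : ℕ) : levelPreserving X →* Perm ((i : Fin n) → X i) :=
  MonoidHom.toHomPerm
    { toFun := fun g => (fun v => truncate n (g.1 (extend o v)) :
        Function.End ((i : Fin n) → X i))
      map_one' := funext fun v => truncate_extend o v
      map_mul' := fun g _ => funext fun _ => truncate_eq_iff.2
        ((g.2 n _ _).2 (agree_extend_truncate o n _).symm) }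

theorem layerPerm_truncate (o : ∀ i, X i) (n : ℕ) (g : levelPreserving X) (x : ∀ i, X i) :
    layerPerm o n g (truncate n x) = truncate n (g.1 x) :=
  truncate_eq_iff.2 ((g.2 n _ _).2 (agree_extend_truncate o n x))

/-- The vertex of level `n` on the path to `x`. -/
def vertexAt (n : ℕ) (x : ∀ i, X i) : Vertex X := ⟨n, truncate n x⟩

theorem exists_vertexAt (o : ∀ i, X i) (u : Vertex X) : ∃ n x, vertexAt n x = u :=
  ⟨u.1, extend o u.2, Sigma.ext rfl (heq_of_eq (truncate_extend o u.2))⟩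

theorem vertexAt_eq_iff {n : ℕ} {x y : ∀ i, X i} : vertexAt n x = vertexAt n y ↔ Agree n x y := by
  rw [← truncate_eq_iff]
  exact ⟨fun h => eq_of_heq (Sigma.ext_iff.1 h).2, fun h => congrArg (Sigma.mk n) h⟩

theorem isPrefix_vertexAt {m n : ℕ} {x y : ∀ i, X i} :
    (vertexAt m x).IsPrefix (vertexAt n y) ↔ m ≤ n ∧ Agree m y x :=
  ⟨fun ⟨h, h'⟩ => ⟨h, fun i hi => h' ⟨i, hi⟩⟩, fun ⟨h, h'⟩ => ⟨h, fun i => h' i i.2⟩⟩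

/-- The action of boundary permutations on the vertices of the tree. -/
def vertexPerm (o : ∀ i, X i) (g : levelPreserving X) : Perm (Vertex X) :=
  Equiv.sigmaCongrRight fun n => layerPerm o n g

theorem vertexPerm_vertexAt (o : ∀ i, X i) (g : levelPreserving X) (n : ℕ) (x : ∀ i, X i) :
    vertexPerm o g (vertexAt n x) = vertexAt n (g.1 x) :=
  congrArg (Sigma.mk n) (layerPerm_truncate o n g x)

/-- The automorphism of the tree induced by a level preserving permutation of the boundary. -/
def treeAut (o : ∀ i, X i) : levelPreserving X →* Aut X where
  toFun g := ⟨⟨vertexPerm o g, by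
      intro u v
      obtain ⟨m, x, rfl⟩ := exists_vertexAt o u
      obtain ⟨n, y, rfl⟩ := exists_vertexAt o v
      rw [vertexPerm_vertexAt, vertexPerm_vertexAt]
      change (_ ∧ _) ∨ (_ ∧ _) ↔ (_ ∧ _) ∨ (_ ∧ _)
      simp only [isPrefix_vertexAt, g.2 _ _ _]
      rfl⟩, Sigma.ext rfl (heq_of_eq (funext fun i => i.elim0))⟩
  map_one' := by
    refine Subtype.ext (RelIso.ext fun u => ?_)
    obtain ⟨n, x, rfl⟩ := exists_vertexAt o u
    exact vertexPerm_vertexAt o 1 _ x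
  map_mul' g h := by
    refine Subtype.ext (RelIso.ext fun u => ?_)
    obtain ⟨n, x, rfl⟩ := exists_vertexAt o u
    refine (vertexPerm_vertexAt o (g * h) _ x).trans ?_
    change _ = vertexPerm o g (vertexPerm o h _)
    rw [vertexPerm_vertexAt, vertexPerm_vertexAt]
    rfl

theorem treeAut_vertexAt (o : ∀ i, X i) (g : levelPreserving X) (n : ℕ) (x : ∀ i, X i) :
    (treeAut o g).1 (vertexAt n x) = vertexAt n (g.1 x) := vertexPerm_vertexAt o g n x

theorem treeAut_injective (o : ∀ i, X i) : Function.Injective (treeAut o) := by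
  rw [injective_iff_map_eq_one]
  intro g hg
  refine Subtype.ext (Equiv.ext fun x => funext fun i => ?_)
  have h := treeAut_vertexAt o g (i + 1) x
  rw [hg] at h
  exact (vertexAt_eq_iff.1 h i i.lt_succ_self).symm

variable {K : Subgroup (Perm (∀ i, X i))}

/-- The group of tree automorphisms induced by a group of level preserving permutations. -/
def inducedAut (o : ∀ i, X i) (hK : K ≤ levelPreserving X) : K →* Aut X :=
  (treeAut o).comp (Subgroup.inclusion hK)

theorem inducedAut_vertexAt (o : ∀ i, X i) (hK : K ≤ levelPreserving X) (g : K) (n : ℕ)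
    (x : ∀ i, X i) : (inducedAut o hK g).1 (vertexAt n x) = vertexAt n (g.1 x) :=
  treeAut_vertexAt o _ n x

theorem inducedAut_injective (o : ∀ i, X i) (hK : K ≤ levelPreserving X) :
    Function.Injective (inducedAut o hK) :=
  (treeAut_injective o).comp (Subgroup.inclusion_injective hK)

theorem inducedAut_mem_rigidVertexStabilizer (o : ∀ i, X i) (hK : K ≤ levelPreserving X)
    {g : K} {n : ℕ} {w : ∀ i, X i} (hg : g.1 ∈ supportedOn (cone w n)) :
    inducedAut o hK g ∈ rigidVertexStabilizer (inducedAut o hK).range (vertexAt n w) := by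
  refine ⟨⟨⟨g, rfl⟩, fun u hu => ?_⟩, ⟨⟨g, rfl⟩, ?_⟩⟩
  · obtain ⟨m, x, rfl⟩ := exists_vertexAt o u
    obtain rfl : m = n := hu
    rw [inducedAut_vertexAt, vertexAt_eq_iff]
    by_cases hx : x ∈ cone w m
    · exact Agree.trans ((apply_mem_iff_of_supportedOn hg x).2 hx) (Agree.symm hx)
    · rw [hg x hx]
      exact Agree.refl _ x
  · rintro v ⟨u, hu, huw, huv⟩
    obtain ⟨k, y, rfl⟩ := exists_vertexAt o v
    obtain ⟨m, x, rfl⟩ := exists_vertexAt o u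
    obtain rfl : m = n := hu
    rw [inducedAut_vertexAt, hg y]
    intro hy
    exact huw (vertexAt_eq_iff.2 ((isPrefix_vertexAt.1 huv).2.symm.trans hy))

theorem inducedAut_mem_rigidLayerStabilizer (o : ∀ i, X i) (hK : K ≤ levelPreserving X)
    {g : K} {n : ℕ} {w : ∀ i, X i} (hg : g.1 ∈ supportedOn (cone w n)) :
    inducedAut o hK g ∈ rigidLayerStabilizer (inducedAut o hK).range n :=
  le_iSup (fun v : {v : Vertex X // v.length = n} =>
    rigidVertexStabilizer (inducedAut o hK).range v.1) ⟨vertexAt n w, rfl⟩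
    (inducedAut_mem_rigidVertexStabilizer o hK hg)

theorem levelStabilizer_relIndex_ne_zero [∀ i, Finite (X i)] (o : ∀ i, X i)
    (hK : K ≤ levelPreserving X) (n : ℕ) : (levelStabilizer X n).relIndex K ≠ 0 := by
  have hle : ((layerPerm o n).comp (Subgroup.inclusion hK)).ker ≤
      (levelStabilizer X n).subgroupOf K := by
    intro g hg x
    have h := layerPerm_truncate o n (Subgroup.inclusion hK g) x
    rw [show layerPerm o n (Subgroup.inclusion hK g) = 1 from hg] at h
    exact (truncate_eq_iff.1 h).symm
  exact (Subgroup.finiteIndex_of_le hle).index_ne_zero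

/-! ### The branch property and transfer of subgroups from `⟨T⟩`. -/

section branch

variable {o e : ∀ i, X i} {T : Set (∀ i, Perm (X i))}

/-- The index is finite in the level group, hence in the part of the group that fixes level `n`,
which has finite index because layers are finite. -/
theorem relIndex_commutator_ne_zero [∀ i, Finite (X i)] (hoe : ∀ n, e n ≠ o n) (hT : T.Finite)
    (hT' : ∀ t ∈ T, IsOfFinOrder t)
    (hK : vertexGroup o e (Subgroup.closure T) o 0 ≤ levelPreserving X) (n : ℕ) :
    (⨆ v : (i : Fin n) → X i, ⁅vertexGroup o e (Subgroup.closure T) (extend o v) n,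
      vertexGroup o e (Subgroup.closure T) (extend o v) n⁆).relIndex
      (vertexGroup o e (Subgroup.closure T) o 0) ≠ 0 := by
  refine Subgroup.relIndex_ne_zero_trans (K := vertexGroup o e (Subgroup.closure T) o 0 ⊓
    levelStabilizer X n) (fun h => ?_) ?_
  · exact relIndex_levelGroup_ne_zero hT hT' (Subgroup.relIndex_eq_zero_of_le_right
      (vertexGroup_inf_levelStabilizer_le hoe n) h)
  · rw [Subgroup.inf_relIndex_left]
    exact levelStabilizer_relIndex_ne_zero o hK n

theorem subgroupOf_iSup_le {Γ ι : Type*} [Group Γ] {H : ι → Subgroup Γ} {K : Subgroup Γ}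
    {L : Subgroup K} (h : ∀ i, ∀ g ∈ H i, ∃ hg : g ∈ K, (⟨g, hg⟩ : K) ∈ L) :
    (⨆ i, H i).subgroupOf K ≤ L := by
  have hmap : ⨆ i, H i ≤ L.map K.subtype := iSup_le fun i g hg => by
    obtain ⟨hgK, hgL⟩ := h i g hg
    exact ⟨⟨g, hgK⟩, hgL, rfl⟩
  intro g hg
  obtain ⟨g', hg', hgg⟩ := hmap hg
  obtain rfl : g' = g := Subtype.ext hgg
  exact hg'

theorem isBranch_range [∀ i, Finite (X i)] (hoe : ∀ n, e n ≠ o n)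
    (h3 : ∀ n (a b : X n), ∃ c, c ≠ a ∧ c ≠ b) (hT : T.Finite) (hT' : ∀ t ∈ T, IsOfFinOrder t)
    (hB : ∀ i (π : Perm (X i)), ∃ b ∈ Subgroup.closure T, b i = π)
    (hK : vertexGroup o e (Subgroup.closure T) o 0 ≤ levelPreserving X) :
    IsBranch (inducedAut o hK).range := by
  refine ⟨fun u v huv => ?_, fun n => ?_⟩
  · obtain ⟨n, x, rfl⟩ := exists_vertexAt o u
    obtain ⟨m, y, rfl⟩ := exists_vertexAt o v
    obtain rfl : n = m := huv
    obtain ⟨g, hg, hgx⟩ := exists_agree_apply (w := o) hoe hB n x y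
    exact ⟨inducedAut o hK ⟨g, hg⟩, ⟨_, rfl⟩,
      (inducedAut_vertexAt o hK ⟨g, hg⟩ _ x).trans (vertexAt_eq_iff.2 hgx)⟩
  · have hDK := relIndex_commutator_ne_zero hoe hT hT' hK n
    have hle : (⨆ v : (i : Fin n) → X i, ⁅vertexGroup o e (Subgroup.closure T) (extend o v) n,
        vertexGroup o e (Subgroup.closure T) (extend o v) n⁆).subgroupOf
        (vertexGroup o e (Subgroup.closure T) o 0) ≤
        (rigidLayerStabilizer (inducedAut o hK).range n).comap (inducedAut o hK) := by
      refine subgroupOf_iSup_le fun v g hg => ?_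
      have hgK : g ∈ vertexGroup o e (Subgroup.closure T) o 0 := by
        rw [vertexGroup_congr (w' := extend o v) fun i hi => absurd hi i.not_lt_zero]
        exact commutator_vertexGroup_le hoe hB h3 _ n hg
      exact ⟨hgK, inducedAut_mem_rigidLayerStabilizer o hK (g := ⟨g, hgK⟩)
        (vertexGroup_le_supportedOn (Subgroup.commutator_le_self _ hg))⟩
    have hne := Subgroup.index_comap (rigidLayerStabilizer (inducedAut o hK).range n)
      (inducedAut o hK)
    refine ⟨fun h0 => hDK (Nat.eq_zero_of_zero_dvd ?_)⟩
    have hdvd := Subgroup.index_dvd_of_le hle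
    rwa [hne.trans h0] at hdvd

theorem fg_vertexGroup [∀ i, Finite (X i)] (hT : T.Finite) {w : ∀ i, X i} {n : ℕ} :
    (vertexGroup o e (Subgroup.closure T) w n).FG :=
  (Subgroup.fg_iff _).2 ⟨_, closure_vertexGenerators T, finite_vertexGenerators hT⟩

/-- Subgroups of `⟨T⟩` that generate it pairwise and are closed under eventual equality yield
pairwise distinct maximal subgroups of the branch group. -/
theorem not_countable_isCoatom_range [∀ i, Finite (X i)] (hoe : ∀ n, e n ≠ o n) (hT : T.Finite)
    {S : Type*} [Uncountable S] (H : S → Subgroup (∀ i, Perm (X i)))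
    (hproper : ∀ s, H s < Subgroup.closure T)
    (hsup : ∀ s t, s ≠ t → H s ⊔ H t = Subgroup.closure T)
    (hev : ∀ s, ∀ a ∈ H s, ∀ b ∈ Subgroup.closure T, (∀ᶠ n in Filter.atTop, b n = a n) → b ∈ H s)
    (hK : vertexGroup o e (Subgroup.closure T) o 0 ≤ levelPreserving X) :
    Group.FG (inducedAut o hK).range ∧
      ¬ {M : Subgroup (inducedAut o hK).range | IsCoatom M}.Countable := by
  have hfg : Group.FG (vertexGroup o e (Subgroup.closure T) o 0) :=
    (Group.fg_iff_subgroup_fg _).2 (fg_vertexGroup hT)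
  have hfg' : Group.FG (inducedAut o hK).range := Group.fg_range _
  refine ⟨hfg', ?_⟩
  let φ : vertexGroup o e (Subgroup.closure T) o 0 ≃* (inducedAut o hK).range :=
    MonoidHom.ofInjective (inducedAut_injective o hK)
  have hle : ∀ s, vertexGroup o e (H s) o 0 ≤ vertexGroup o e (Subgroup.closure T) o 0 :=
    fun s => vertexGroup_mono (hproper s).le
  refine GroupLemmas.not_countable_isCoatom hfg' (fun s => ((vertexGroup o e (H s) o 0).subgroupOf
    (vertexGroup o e (Subgroup.closure T) o 0)).map φ.toMonoidHom) (fun s hs => ?_)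
    fun s t hst => ?_
  · rw [← Subgroup.map_top_of_surjective φ.toMonoidHom φ.surjective] at hs
    have htop := Subgroup.subgroupOf_eq_top.1 (Subgroup.map_injective φ.injective hs)
    refine (hproper s).not_ge fun b hb => ?_
    obtain ⟨a, ha, hab⟩ := eventually_eq_of_directed_mem hoe (htop (directed_mem_vertexGroup hb))
    exact hev s a ha b hb hab
  · rw [← Subgroup.map_sup, ← Subgroup.subgroupOf_sup (hle s) (hle t), ← vertexGroup_sup,
      hsup s t hst, Subgroup.subgroupOf_self]
    exact Subgroup.map_top_of_surjective φ.toMonoidHom φ.surjective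

end branch

end BoundaryAction

/-! ### The group of matchings and its uniform transpositions. -/

namespace PathGroup

open Equiv

/-- On the path `0, …, N - 1` the map that interchanges the ends of the edges `{z, z + 1}` with
`E z`. -/
noncomputable def pathMap (E : ℕ → Prop) (N : ℕ) (z : Fin N) : Fin N :=
  open Classical in
  if h : E z ∧ (z : ℕ) + 1 < N then ⟨z + 1, h.2⟩
  -- The bound `1 ≤ z` excludes the truncated value `0 - 1 = 0`.
  else if E (z - 1) ∧ 1 ≤ (z : ℕ) then ⟨z - 1, by omega⟩ else z

variable {E : ℕ → Prop} {N : ℕ}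

theorem pathMap_of_edge {z : ℕ} (hz : z + 1 < N) (h : E z) :
    pathMap E N ⟨z, by omega⟩ = ⟨z + 1, hz⟩ := dif_pos ⟨h, hz⟩

theorem pathMap_succ_of_edge {z : ℕ} (hz : z + 1 < N) (h : E z) (h' : ¬ E (z + 1)) :
    pathMap E N ⟨z + 1, hz⟩ = ⟨z, by omega⟩ := by
  rw [pathMap, dif_neg fun hE => h' hE.1, if_pos ⟨by simpa using h, by simp⟩]
  simp

theorem pathMap_of_not_edge {z : ℕ} (hz : z < N) (h : E z → N ≤ z + 1)
    (h' : 1 ≤ z → ¬ E (z - 1)) : pathMap E N ⟨z, hz⟩ = ⟨z, hz⟩ := by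
  rw [pathMap, dif_neg fun hE => (h hE.1).not_gt hE.2, if_neg fun hE => h' hE.2 hE.1]

theorem pathMap_involutive (hE : ∀ z, E z → ¬ E (z + 1)) :
    Function.Involutive (pathMap E N) := by
  rintro ⟨z, hz⟩
  by_cases h : E z ∧ z + 1 < N
  · rw [pathMap_of_edge h.2 h.1, pathMap_succ_of_edge h.2 h.1 (hE z h.1)]
  by_cases h' : E (z - 1) ∧ 1 ≤ z
  · obtain ⟨y, rfl⟩ := Nat.exists_eq_add_of_le' h'.2
    have hy : E y := by simpa using h'.1
    rw [pathMap_succ_of_edge hz hy (hE y hy), pathMap_of_edge hz hy]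
  · rw [pathMap_of_not_edge hz (fun hz' => not_lt.1 fun hlt => h ⟨hz', hlt⟩)
      fun h1 h2 => h' ⟨h2, h1⟩, pathMap_of_not_edge hz (fun hz' => not_lt.1 fun hlt => h ⟨hz', hlt⟩)
      fun h1 h2 => h' ⟨h2, h1⟩]

/-- A family of involutions on the paths `0, …, n + 2` given by matchings. -/
noncomputable def matching (E : ℕ → ℕ → Prop) (hE : ∀ n z, E n z → ¬ E n (z + 1)) :
    ∀ n, Perm (Fin (n + 3)) :=
  fun n => (pathMap_involutive (E := E n) (N := n + 3) (hE n)).toPerm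

theorem matching_apply (E : ℕ → ℕ → Prop) (hE : ∀ n z, E n z → ¬ E n (z + 1)) (n : ℕ)
    (z : Fin (n + 3)) : matching E hE n z = pathMap (E n) (n + 3) z := rfl

theorem matching_mul_self (E : ℕ → ℕ → Prop) (hE : ∀ n z, E n z → ¬ E n (z + 1)) :
    matching E hE * matching E hE = 1 :=
  funext fun n => Equiv.ext fun z => pathMap_involutive (hE n) z

/-- The matching of all edges `{z, z + 1}` with `z` even. -/
noncomputable def evenMatching : ∀ n, Perm (Fin (n + 3)) :=
  matching (fun _ z => Even z) fun _ z h => by rw [Nat.even_add_one]; exact not_not.2 h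

/-- The matching of all edges `{z, z + 1}` with `z` odd. -/
noncomputable def oddMatching : ∀ n, Perm (Fin (n + 3)) :=
  matching (fun _ z => Odd z) fun _ z h => by rw [Nat.odd_add_one]; exact not_not.2 h

/-- The matching of the single edge `{0, 1}`. -/
noncomputable def firstMatching : ∀ n, Perm (Fin (n + 3)) :=
  matching (fun _ z => z = 0) fun _ _ _ => Nat.succ_ne_zero _

/-- The matching of the edges `{2i, 2i + 1}` of the `n`-th path such that the `i`-th binary digit
of `n` is one. -/
noncomputable def digitMatching : ∀ n, Perm (Fin (n + 3)) :=
  matching (fun n z => Even z ∧ n.testBit (z / 2)) fun _ _ h h' =>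
    (Nat.even_add_one.1 h'.1) h.1

/-- The generators of the group of matchings. -/
def generators : Set (∀ n, Perm (Fin (n + 3))) :=
  {evenMatching, oddMatching, firstMatching, digitMatching}

theorem mul_self_of_mem_generators {t : ∀ n, Perm (Fin (n + 3))} (ht : t ∈ generators) :
    t * t = 1 := by
  rcases ht with rfl | rfl | rfl | rfl <;> exact matching_mul_self _ _

/-- The group generated by the matchings. -/
def group : Subgroup (∀ n, Perm (Fin (n + 3))) := Subgroup.closure generators

theorem evenMatching_mem : evenMatching ∈ group := Subgroup.subset_closure (Or.inl rfl)

theorem oddMatching_mem : oddMatching ∈ group := Subgroup.subset_closure (Or.inr (Or.inl rfl))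

theorem firstMatching_mem : firstMatching ∈ group :=
  Subgroup.subset_closure (Or.inr (Or.inr (Or.inl rfl)))

theorem digitMatching_mem : digitMatching ∈ group :=
  Subgroup.subset_closure (Or.inr (Or.inr (Or.inr rfl)))

theorem firstMatching_eq_swap (n : ℕ) :
    firstMatching n = swap ⟨0, by omega⟩ ⟨1, by omega⟩ := by
  ext1 ⟨z, hz⟩
  rw [firstMatching, matching_apply]
  rcases z with _ | _ | z
  · rw [swap_apply_left, pathMap_of_edge (E := fun z => z = 0) (by omega) rfl]
  · rw [swap_apply_right, pathMap_succ_of_edge (E := fun z => z = 0) (by omega) rfl (by omega)]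
  · rw [swap_apply_of_ne_of_ne (by simp) (by simp), pathMap_of_not_edge hz (by omega) (by omega)]

/-- The matching with the parity of `z` shifts `z` and `z + 2` together. Conjugation by it turns the
transposition of `z`, `z + 2` into that of `z + 1`, `z + 3`, with one element serving all `n`. -/
theorem exists_apply_succ (z : ℕ) : ∃ a ∈ group, ∀ n, (∀ hz : z + 1 < n + 3,
    a n ⟨z, by omega⟩ = ⟨z + 1, hz⟩) ∧ ∀ hz : z + 3 < n + 3,
    a n ⟨z + 2, by omega⟩ = ⟨z + 3, hz⟩ := by
  rcases Nat.even_or_odd z with h | h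
  · exact ⟨_, evenMatching_mem, fun n => ⟨fun hz => pathMap_of_edge hz h,
      fun hz => pathMap_of_edge hz (h.add even_two)⟩⟩
  · exact ⟨_, oddMatching_mem, fun n => ⟨fun hz => pathMap_of_edge hz h,
      fun hz => pathMap_of_edge hz (h.add_even even_two)⟩⟩

theorem exists_swap_add_two (z : ℕ) : ∃ a ∈ group, ∀ n (hz : z + 2 < n + 3),
    a n = swap ⟨z, by omega⟩ ⟨z + 2, hz⟩ := by
  induction z with
  | zero =>
    refine ⟨oddMatching * firstMatching * oddMatching⁻¹,
      mul_mem (mul_mem oddMatching_mem firstMatching_mem) (inv_mem oddMatching_mem),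
      fun n hz => ?_⟩
    have h0 : oddMatching n ⟨0, by omega⟩ = ⟨0, by omega⟩ :=
      pathMap_of_not_edge _ (fun h => by simp at h) (by omega)
    have h1 : oddMatching n ⟨1, by omega⟩ = ⟨2, by omega⟩ :=
      pathMap_of_edge (by omega) odd_one
    rw [Pi.mul_apply, Pi.mul_apply, Pi.inv_apply, firstMatching_eq_swap, ← swap_apply_apply,
      h0, h1]
  | succ z ih =>
    obtain ⟨h, hh, hswap⟩ := ih
    obtain ⟨a, ha, haz⟩ := exists_apply_succ z
    refine ⟨a * h * a⁻¹, mul_mem (mul_mem ha hh) (inv_mem ha), fun n hz => ?_⟩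
    rw [Pi.mul_apply, Pi.mul_apply, Pi.inv_apply, hswap n (by omega), ← swap_apply_apply,
      (haz n).1 (by omega), (haz n).2 (by omega)]

theorem exists_swap_zero (z : ℕ) : ∃ a ∈ group, ∀ n (hz : z < n + 3),
    a n = swap ⟨0, by omega⟩ ⟨z, hz⟩ := by
  induction z using Nat.twoStepInduction with
  | zero => exact ⟨1, one_mem _, fun n hz => (swap_self _).symm⟩
  | one => exact ⟨_, firstMatching_mem, fun n hz => firstMatching_eq_swap n⟩
  | more z ih _ =>
    obtain ⟨h, hh, hswap⟩ := ih
    obtain ⟨a, ha, haz⟩ := exists_swap_add_two z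
    rcases Nat.eq_zero_or_pos z with rfl | hpos
    · exact ⟨a, ha, haz⟩
    refine ⟨a * h * a⁻¹, mul_mem (mul_mem ha hh) (inv_mem ha), fun n hz => ?_⟩
    rw [Pi.mul_apply, Pi.mul_apply, Pi.inv_apply, hswap n (by omega), ← swap_apply_apply,
      haz n hz, swap_apply_left, swap_apply_of_ne_of_ne]
    · simpa [Fin.ext_iff] using hpos.ne
    · simp [Fin.ext_iff]

theorem exists_swap (x y : ℕ) : ∃ a ∈ group, ∀ n (hx : x < n + 3) (hy : y < n + 3),
    a n = swap ⟨x, hx⟩ ⟨y, hy⟩ := by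
  obtain ⟨a, ha, hax⟩ := exists_swap_zero x
  obtain ⟨b, hb, hby⟩ := exists_swap_zero y
  rcases eq_or_ne y 0 with rfl | hy0
  · exact ⟨a, ha, fun n hx hy => by rw [hax n hx, swap_comm]⟩
  rcases eq_or_ne x y with rfl | hxy
  · exact ⟨1, one_mem _, fun n hx hy => (swap_self _).symm⟩
  refine ⟨a * b * a⁻¹, mul_mem (mul_mem ha hb) (inv_mem ha), fun n hx hy => ?_⟩
  rw [Pi.mul_apply, Pi.mul_apply, Pi.inv_apply, hby n hy, ← swap_apply_apply, hax n hx,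
    swap_apply_left, swap_apply_of_ne_of_ne]
  · simpa [Fin.ext_iff] using hy0
  · simpa [Fin.ext_iff] using hxy.symm

theorem exists_mem_group_apply_eq (n : ℕ) (π : Perm (Fin (n + 3))) : ∃ b ∈ group, b n = π := by
  have htop : group.map (Pi.evalMonoidHom (fun n => Perm (Fin (n + 3))) n) = ⊤ := by
    rw [← top_le_iff, ← Perm.closure_isSwap, Subgroup.closure_le]
    rintro _ ⟨x, y, -, rfl⟩
    obtain ⟨a, ha, hswap⟩ := exists_swap x y
    exact ⟨a, ha, hswap n x.2 y.2⟩
  obtain ⟨b, hb, hbπ⟩ := htop ▸ Subgroup.mem_top π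
  exact ⟨b, hb, hbπ⟩

/-! ### Limit actions on `ℕ` and their point stabilizers. -/

/-- A number that is at least `L` and whose first `L` binary digits are given by `s`. -/
noncomputable def approx (s : ℕ → Bool) (L : ℕ) : ℕ :=
  -- The digit `L` is one, which makes the value at least `2 ^ L`.
  Nat.ofBits (fun i : Fin (L + 1) => if (i : ℕ) < L then s i else true)

theorem testBit_approx (s : ℕ → Bool) {L i : ℕ} (h : i < L) : (approx s L).testBit i = s i := by
  rw [approx, Nat.testBit_ofBits_lt _ _ (by omega)]
  simp [h]

theorem le_approx (s : ℕ → Bool) (L : ℕ) : L ≤ approx s L := by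
  have h : (approx s L).testBit L = true := by
    rw [approx, Nat.testBit_ofBits_lt _ _ (by omega)]
    simp
  exact (Nat.lt_two_pow_self.le).trans (Nat.ge_two_pow_of_testBit h)

open Filter

theorem tendsto_approx (s : ℕ → Bool) : Tendsto (approx s) atTop atTop :=
  tendsto_atTop_mono (le_approx s) tendsto_id

theorem exists_eventually_matching (E : ℕ → ℕ → Prop) (hE : ∀ n z, E n z → ¬ E n (z + 1))
    (s : ℕ → Bool) (hlim : ∀ z, ∃ P : Prop, ∀ᶠ L in atTop, E (approx s L) z ↔ P) (z : ℕ) :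
    ∃ y : ℕ, ∀ᶠ L in atTop, ∀ hz : z < approx s L + 3,
      (matching E hE (approx s L) ⟨z, hz⟩ : ℕ) = y := by
  obtain ⟨P, hP⟩ := hlim z
  obtain ⟨Q, hQ⟩ := hlim (z - 1)
  have hlarge : ∀ᶠ L in atTop, z + 1 < approx s L + 3 := by
    filter_upwards [eventually_ge_atTop z] with L hL
    have := le_approx s L
    omega
  by_cases h : P
  · refine ⟨z + 1, ?_⟩
    filter_upwards [hP, hlarge] with L hL hL' hz
    rw [matching_apply, pathMap_of_edge hL' (hL.2 h)]
  by_cases h' : Q ∧ 1 ≤ z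
  · obtain ⟨x, rfl⟩ := Nat.exists_eq_add_of_le' h'.2
    refine ⟨x, ?_⟩
    filter_upwards [hQ] with L hL hz
    have hx : E (approx s L) x := hL.2 h'.1
    rw [matching_apply, pathMap_succ_of_edge hz hx (hE _ _ hx)]
  · refine ⟨z, ?_⟩
    filter_upwards [hP, hQ] with L hL hL' hz
    rw [matching_apply, pathMap_of_not_edge hz (fun hz' => absurd (hL.1 hz') h)
      fun h1 h2 => h' ⟨hL'.1 h2, h1⟩]

/-- The limit action exists: a generator moves `z` according to the edges at `z` only, and whether
these are present is eventually constant because each binary digit of `approx s L` is. -/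
theorem exists_eventually_apply {b : ∀ n, Perm (Fin (n + 3))} (hb : b ∈ group) (s : ℕ → Bool)
    (z : ℕ) : ∃ y : ℕ, ∀ᶠ L in atTop, ∀ hz : z < approx s L + 3,
      (b (approx s L) ⟨z, hz⟩ : ℕ) = y := by
  have hgen : ∀ t ∈ generators, ∀ z, ∃ y : ℕ, ∀ᶠ L in atTop, ∀ hz : z < approx s L + 3,
      (t (approx s L) ⟨z, hz⟩ : ℕ) = y := by
    rintro t (rfl | rfl | rfl | rfl)
    · exact exists_eventually_matching _ _ s fun z => ⟨_, Eventually.of_forall fun _ => Iff.rfl⟩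
    · exact exists_eventually_matching _ _ s fun z => ⟨_, Eventually.of_forall fun _ => Iff.rfl⟩
    · exact exists_eventually_matching _ _ s fun z => ⟨_, Eventually.of_forall fun _ => Iff.rfl⟩
    · refine exists_eventually_matching _ _ s fun z => ⟨Even z ∧ s (z / 2), ?_⟩
      filter_upwards [eventually_gt_atTop (z / 2)] with L hL
      rw [testBit_approx s hL]
  have hmul : ∀ t ∈ generators, ∀ c : ∀ n, Perm (Fin (n + 3)),
      (∀ z, ∃ y : ℕ, ∀ᶠ L in atTop, ∀ hz : z < approx s L + 3,
        (c (approx s L) ⟨z, hz⟩ : ℕ) = y) →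
      ∀ z, ∃ y : ℕ, ∀ᶠ L in atTop, ∀ hz : z < approx s L + 3,
        ((t * c) (approx s L) ⟨z, hz⟩ : ℕ) = y := by
    intro t ht c hc z
    obtain ⟨y, hy⟩ := hc z
    obtain ⟨x, hx⟩ := hgen t ht y
    refine ⟨x, ?_⟩
    filter_upwards [hy, hx] with L hL hL' hz
    have hval := hL hz
    have hlt : y < approx s L + 3 := hval ▸ (c (approx s L) ⟨z, hz⟩).2
    rw [Pi.mul_apply, Perm.mul_apply, show c (approx s L) ⟨z, hz⟩ = ⟨y, hlt⟩ from Fin.ext hval]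
    exact hL' hlt
  rw [group] at hb
  induction hb using Subgroup.closure_induction_left generalizing z with
  | one => exact ⟨z, Eventually.of_forall fun _ _ => rfl⟩
  | mul_left t ht c _ ih => exact hmul t ht c ih z
  | inv_mul_cancel t ht c _ ih =>
    rw [inv_eq_of_mul_eq_one_left (mul_self_of_mem_generators ht)]
    exact hmul t ht c ih z

/-- The stabilizer of the point `0` in the limit of the actions along the numbers `approx s L`. -/
def limitStabilizer (s : ℕ → Bool) : Subgroup (∀ n, Perm (Fin (n + 3))) where
  carrier := {b | b ∈ group ∧ ∀ᶠ L in atTop, b (approx s L) 0 = 0}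
  one_mem' := ⟨one_mem _, Eventually.of_forall fun _ => rfl⟩
  mul_mem' := by
    rintro a b ⟨ha, ha'⟩ ⟨hb, hb'⟩
    refine ⟨mul_mem ha hb, ?_⟩
    filter_upwards [ha', hb'] with L h h'
    rw [Pi.mul_apply, Perm.mul_apply, h', h]
  inv_mem' := by
    rintro a ⟨ha, ha'⟩
    refine ⟨inv_mem ha, ?_⟩
    filter_upwards [ha'] with L h
    rw [Pi.inv_apply, Perm.inv_eq_iff_eq, h]

theorem limitStabilizer_le (s : ℕ → Bool) : limitStabilizer s ≤ group := fun _ h => h.1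

/-- The limit actions are doubly transitive, so the stabilizers are maximal. -/
theorem group_le_of_limitStabilizer_le {s : ℕ → Bool} {K : Subgroup (∀ n, Perm (Fin (n + 3)))}
    (hK : limitStabilizer s ≤ K) {c : ∀ n, Perm (Fin (n + 3))} (hcK : c ∈ K) (hc : c ∈ group)
    (hcs : c ∉ limitStabilizer s) : group ≤ K := by
  intro d hd
  obtain ⟨x, hx⟩ := exists_eventually_apply hc s 0
  obtain ⟨y, hy⟩ := exists_eventually_apply hd s 0
  have hx0 : x ≠ 0 := by
    rintro rfl
    exact hcs ⟨hc, hx.mono fun L hL => Fin.ext (hL (by omega))⟩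
  rcases eq_or_ne y 0 with rfl | hy0
  · exact hK ⟨hd, hy.mono fun L hL => Fin.ext (hL (by omega))⟩
  obtain ⟨a, ha, hswap⟩ := exists_swap x y
  have haK : a ∈ K := by
    refine hK ⟨ha, ?_⟩
    filter_upwards [eventually_ge_atTop (max x y)] with L hL
    have := le_approx s L
    rw [hswap _ (by omega) (by omega), swap_apply_of_ne_of_ne]
    · simpa [Fin.ext_iff] using hx0.symm
    · simpa [Fin.ext_iff] using hy0.symm
  -- In the limit `c` sends `0` to `x`, `a` swaps `x` and `y`, and `d` sends `0` to `y`, so this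
  -- element fixes `0`.
  have hrest : (a * c)⁻¹ * d ∈ K := by
    refine hK ⟨mul_mem (inv_mem (mul_mem ha hc)) hd, ?_⟩
    filter_upwards [hx, hy, eventually_ge_atTop (max x y)] with L hL hL' hmax
    have := le_approx s L
    have hxL : c (approx s L) 0 = ⟨x, by omega⟩ := Fin.ext (hL (by omega))
    have hyL : d (approx s L) 0 = ⟨y, by omega⟩ := Fin.ext (hL' (by omega))
    rw [Pi.mul_apply, Perm.mul_apply, Pi.inv_apply, Perm.inv_eq_iff_eq, Pi.mul_apply,
      Perm.mul_apply, hxL, hyL, hswap _ (by omega) (by omega), swap_apply_left]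
  have hmem := mul_mem (mul_mem haK hcK) hrest
  rwa [mul_inv_cancel_left] at hmem

/-- In the limit along `s`, `digitMatching` moves `2 * i` exactly when `s i` is true. Conjugation by
the transposition of `0` and `2 * i` carries this test to the point `0`. -/
theorem exists_mem_limitStabilizer_notMem {s t : ℕ → Bool} {i : ℕ} (hs : s i = true)
    (ht : t i = false) : ∃ c ∈ limitStabilizer t, c ∉ limitStabilizer s := by
  obtain ⟨a, ha, hswap⟩ := exists_swap_zero (2 * i)
  have hmem : a⁻¹ * digitMatching * a ∈ group :=
    mul_mem (mul_mem (inv_mem ha) digitMatching_mem) ha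
  have hpath : ∀ (s : ℕ → Bool) L (_ : 2 * i + 1 ≤ L), a (approx s L) 0 = ⟨2 * i, by
      have := le_approx s L; omega⟩ := fun s L hL => by
    have := le_approx s L
    rw [hswap _ (by omega)]
    exact swap_apply_left _ _
  refine ⟨a⁻¹ * digitMatching * a, ⟨hmem, ?_⟩, ?_⟩
  · filter_upwards [eventually_ge_atTop (2 * i + 1)] with L hL
    have := le_approx t L
    rw [Pi.mul_apply, Pi.mul_apply, Perm.mul_apply, Perm.mul_apply, Pi.inv_apply,
      Perm.inv_eq_iff_eq, hpath t L hL, digitMatching, matching_apply, pathMap_of_not_edge]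
    · rintro ⟨-, h⟩
      rw [testBit_approx t (by omega)] at h
      simp [ht] at h
    · rintro h1 ⟨h2, -⟩
      rw [Nat.even_iff] at h2
      omega
  · rintro ⟨-, h⟩
    obtain ⟨L, hL0, hL⟩ := (h.and (eventually_ge_atTop (2 * i + 1))).exists
    have := le_approx s L
    rw [Pi.mul_apply, Pi.mul_apply, Perm.mul_apply, Perm.mul_apply, Pi.inv_apply,
      Perm.inv_eq_iff_eq, hpath s L hL, digitMatching, matching_apply,
      pathMap_of_edge (by omega)] at hL0
    · simp [Fin.ext_iff] at hL0
    · refine ⟨even_two_mul i, ?_⟩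
      rw [testBit_approx s (by omega)]
      simpa using hs

theorem limitStabilizer_sup {s t : ℕ → Bool} (h : s ≠ t) :
    limitStabilizer s ⊔ limitStabilizer t = group := by
  refine le_antisymm (sup_le (limitStabilizer_le s) (limitStabilizer_le t)) ?_
  obtain ⟨i, hi⟩ := Function.ne_iff.1 h
  rcases hs : s i with _ | _
  · have ht : t i = true := by
      rw [hs] at hi
      simpa using hi.symm
    obtain ⟨c, hc, hc'⟩ := exists_mem_limitStabilizer_notMem ht hs
    exact group_le_of_limitStabilizer_le le_sup_right (Subgroup.mem_sup_left hc) hc.1 hc'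
  · have ht : t i = false := by
      rw [hs] at hi
      simpa using hi.symm
    obtain ⟨c, hc, hc'⟩ := exists_mem_limitStabilizer_notMem hs ht
    exact group_le_of_limitStabilizer_le le_sup_left (Subgroup.mem_sup_right hc) hc.1 hc'

theorem limitStabilizer_lt (s : ℕ → Bool) : limitStabilizer s < group := by
  refine (limitStabilizer_le s).lt_of_not_ge fun h => ?_
  obtain ⟨L, hL⟩ := (h firstMatching_mem).2.exists
  rw [firstMatching_eq_swap] at hL
  have h1 : swap (⟨0, by omega⟩ : Fin (approx s L + 3)) ⟨1, by omega⟩ 0 = ⟨1, by omega⟩ :=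
    swap_apply_left _ _
  rw [h1] at hL
  simp at hL

theorem mem_limitStabilizer_of_eventually_eq {s : ℕ → Bool} {a b : ∀ n, Perm (Fin (n + 3))}
    (ha : a ∈ limitStabilizer s) (hb : b ∈ group) (h : ∀ᶠ n in atTop, b n = a n) :
    b ∈ limitStabilizer s := by
  refine ⟨hb, ?_⟩
  filter_upwards [ha.2, (tendsto_approx s).eventually h] with L hL hL'
  rw [hL', hL]

end PathGroup

/-! ### Assembly of the example. -/

theorem corollary3p6 :
    ∃ (X : ℕ → Type) (G : Subgroup (RootedTree.Aut X)),
      (∀ n, Finite (X n)) ∧ (∀ n, 2 ≤ Nat.card (X n)) ∧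
      RootedTree.IsBranch G ∧ Group.FG G ∧
      ¬ {M : Subgroup G | IsCoatom M}.Countable := by
  have : Uncountable (ℕ → Bool) :=
    Cardinal.aleph0_lt_mk_iff.1 (by simpa using Cardinal.cantor Cardinal.aleph0)
  have hoe : ∀ n, (1 : Fin (n + 3)) ≠ 0 := fun n => by simp
  have hT : PathGroup.generators.Finite := by simp [PathGroup.generators]
  have hK := BoundaryAction.vertexGroup_le_levelPreserving (X := fun n => Fin (n + 3))
    (o := fun _ => 0) (e := fun _ => 1) (B := PathGroup.group) (w := fun _ => 0) (n := 0)
  -- At least three letters serve the commutator argument, and the growing alphabets let the finite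
  -- paths tend to an infinite one.
  refine ⟨fun n => Fin (n + 3), (BoundaryAction.inducedAut (fun _ => 0) hK).range,
    fun n => inferInstance, fun n => by rw [Nat.card_fin]; omega,
    BoundaryAction.isBranch_range hoe (fun n a b => ?_) hT (fun t ht => ?_)
      PathGroup.exists_mem_group_apply_eq hK,
    BoundaryAction.not_countable_isCoatom_range hoe hT PathGroup.limitStabilizer
      PathGroup.limitStabilizer_lt (fun _ _ => PathGroup.limitStabilizer_sup)
      (fun _ _ ha _ => PathGroup.mem_limitStabilizer_of_eventually_eq ha) hK⟩
  · obtain ⟨c, hc⟩ := Finset.exists_mem_notMem_of_card_lt_card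
      (s := {a, b}) (t := (Finset.univ : Finset (Fin (n + 3))))
      (by rw [Finset.card_fin]; exact Finset.card_le_two.trans_lt (by omega))
    exact ⟨c, by simpa using hc.2⟩
  · exact isOfFinOrder_iff_pow_eq_one.2
      ⟨2, two_pos, by rw [pow_two, PathGroup.mul_self_of_mem_generators ht]⟩
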